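/- \textbf{Conventions.} An exact category is an additive category with a family of kernel–cokernel pairs satisfying the axioms of Quillen in Keller's form; $\mathcal M$ and $\mathcal E$ denote its admissible monomorphisms and epimorphisms. An exact functor is an additive functor preserving the exact sequences. Weak equivalences of groupoids are equivalences of categories, fibrations are isofibrations; pullbacks of groupoids are strict. Let $\Sigma$ be $\Delta\times\Delta$ with a new terminal object $[-1]$ added, and let $p\colon\Sigma\to\Delta$ be the functor extending the ordinal sum, so that $p(q,r)=[q+1+r]$ and $p(-1)=[0]$. A preaugmented bisimplicial groupoid is a functor $Y\colon\Sigma^{\mathrm{op}}\to\mathcal Gpd$, and $S_\bullet=p_*$ is the right adjoint, given by right Kan extension, of $p^*$ from simplicial to preaugmented bisimplicial groupoids. For an exact category $\mathcal A$: \begin{itemize} \item The exact nerve $N^e\mathcal A$ has in degree $(q,r)$ the full subgroupoid of $\mathrm{Fun}([q]\times[r],\mathcal A)_{\mathrm{iso}}$ on the grids with horizontal morphisms $(i,j)\to(i,j')$ in $\mathcal M$, vertical morphisms $(i,j)\to(i',j)$ in $\mathcal E$ and all squares bicartesian; $(N^e\mathcal A)_{-1}$ is the groupoid of zero objects, included in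 $(N^e\mathcal A)_{0,0}=\mathcal A_{\mathrm{iso}}$. \item $S^e_n(\mathcal A)$ is the full subgroupoid of $\mathrm{Fun}(\mathrm{Ar}[n],\mathcal A)_{\mathrm{iso}}$, where $\mathrm{Ar}[n]=\mathrm{Fun}([1],[n])$, on the diagrams with horizontal morphisms in $\mathcal M$, vertical morphisms in $\mathcal E$, all squares bicartesian and (arbitrary) zero objects on the diagonal. \item The comparison map $c_{\mathcal A}\colon S^e_\bullet(\mathcal A)\to S_\bullet(N^e\mathcal A)$ is adjoint to the map $p^*S^e_\bullet(\mathcal A)\to N^e\mathcal A$ which in degree $(q,r)$ restricts diagrams along $[q]\times[r]\to\mathrm{Ar}[q+1+r]$, $(a,b)\mapsto(a\le q+1+b)$, and in degree $-1$ takes the value of a diagram of shape $\mathrm{Ar}[0]$. \end{itemize} For a simplicial object $X$ let $P^\triangleleft X=X([0]\star-)$, with the map $d_0\colon P^\triangleleft X\to X$ induced by the inclusions $[n]\to[0]\star[n]$. For a preaugmented bisimplicial object $Y$ let $(P^\triangleleft Y)_{q,r}=Y_{1+q,r}$ and $(P^\triangleleft Y)_{-1}=Y_{1,0}\times_{Y_{0,0}}Y_{-1}$,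 formed along $d_0\colon Y_{1,0}\to Y_{0,0}$, with augmentation map the first projection; again there is $d_0\colon P^\triangleleft Y\to Y$, the second projection in degree $-1$. Let $\varphi_Y\colon P^\triangleleft(S_\bullet Y)\to S_\bullet(P^\triangleleft Y)$ be the map adjoint to $p^*P^\triangleleft(S_\bullet Y)\to P^\triangleleft Y$ which in degree $(q,r)$ is the counit $(S_\bullet Y)_{(1+q)+1+r}\to Y_{1+q,r}$ and in degree $-1$ is the map $(S_\bullet Y)_1\to Y_{1,0}\times_{Y_{0,0}}Y_{-1}$ whose first component is the map $(S_\bullet Y)_1\to(S_\bullet Y)_2$ induced by $[2]\to[1]$, $0,1,2\mapsto 0,1,1$, followed by the counit $(S_\bullet Y)_2\to Y_{1,0}$, and whose second component is $d_0\colon(S_\bullet Y)_1\to(S_\bullet Y)_0$ followed by the counit $(S_\bullet Y)_0\to Y_{-1}$. For an exact functor $f\colon\mathcal A\to\mathcal B$ set \[ S^{\mathrm{rel}}_\bullet(f)=P^\triangleleft S^e_\bullet(\mathcal B)\times_{S^e_\bullet(\mathcal B)}S^e_\bullet(\mathcal A),\qquad N^{\mathrm{rel}}f=P^\triangleleft(N^e\mathcal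 B)\times_{N^e\mathcal B}N^e\mathcal A, \] the pullbacks of $d_0$ along $S^e_\bullet(f)$ and along $N^ef$, respectively. \textbf{Theorem.} Let $f\colon\mathcal A\to\mathcal B$ be an exact functor of exact categories. The comparison maps $c_{\mathcal A}\colon S^e_\bullet(\mathcal A)\to S_\bullet(N^e\mathcal A)$ and $c_{\mathcal B}\colon S^e_\bullet(\mathcal B)\to S_\bullet(N^e\mathcal B)$ are isomorphisms of simplicial groupoids, the map $\varphi_{N^e\mathcal B}\colon P^\triangleleft(S_\bullet N^e\mathcal B)\to S_\bullet(P^\triangleleft N^e\mathcal B)$ is a levelwise acyclic fibration of groupoids, and there is a levelwise weak equivalence of simplicial groupoids \[ w\colon S^{\mathrm{rel}}_\bullet(f)\longrightarrow S_\bullet(N^{\mathrm{rel}}f) \] which is induced by these maps: its composite with $S_\bullet(N^{\mathrm{rel}}f)\to S_\bullet(P^\triangleleft N^e\mathcal B)$ is the projection to $P^\triangleleft S^e_\bullet(\mathcal B)$ followed by $\varphi_{N^e\mathcal B}\circ P^\triangleleft(c_{\mathcal B})$, and its composite with $S_\bullet(N^{\mathrm{rel}}f)\to S_\bullet(N^e\mathcal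 A)$ is the projection to $S^e_\bullet(\mathcal A)$ followed by $c_{\mathcal A}$. -/

import Mathlib

open CategoryTheory CategoryTheory.Limits Opposite
open scoped Simplicial

universe v u

namespace Sdot

/-! ## Small limits of groupoids -/

section GrpdLimits

variable {J : Type} [SmallCategory J] (F : J ⥤ Grpd.{v, u})

/-- The explicit limit of a diagram of groupoids: objects are strictly compatible families of
objects, morphisms are compatible families of morphisms. -/
structure GrpdLimit where
  obj : ∀ j, F.obj j
  compat : ∀ {i j : J} (f : i ⟶ j), (F.map f).obj (obj i) = obj j

namespace GrpdLimit

variable {F}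

/-- Compatible families of morphisms. -/
@[ext]
structure Hom (x y : GrpdLimit F) where
  app : ∀ j, x.obj j ⟶ y.obj j
  compat : ∀ {i j : J} (f : i ⟶ j),
    (F.map f).map (app i) = eqToHom (x.compat f) ≫ app j ≫ eqToHom (y.compat f).symm

instance groupoid : Groupoid.{v} (GrpdLimit F) where
  Hom := Hom
  id x := ⟨fun _ => 𝟙 _, fun f => by simp⟩
  comp a b := ⟨fun j => a.app j ≫ b.app j, fun f => by simp [a.compat f, b.compat f]⟩
  id_comp a := Hom.ext (by funext j; exact Category.id_comp _)
  comp_id a := Hom.ext (by funext j; exact Category.comp_id _)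
  assoc a b c := Hom.ext (by funext j; exact Category.assoc _ _ _)
  inv a := ⟨fun j => Groupoid.inv (a.app j), fun f => by
    simp only [Groupoid.inv_eq_inv, Functor.map_inv, a.compat f, IsIso.inv_comp, inv_eqToHom,
      Category.assoc]⟩
  inv_comp a := Hom.ext (by funext j; exact Groupoid.inv_comp _)
  comp_inv a := Hom.ext (by funext j; exact Groupoid.comp_inv _)

theorem hom_ext {x y : GrpdLimit F} {a b : x ⟶ y} (h : ∀ j, a.app j = b.app j) : a = b :=
  Hom.ext (funext h)

theorem obj_ext {x y : GrpdLimit F} (h : ∀ j, x.obj j = y.obj j) : x = y := by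
  cases x; cases y; congr; exact funext h

theorem eqToHom_app {x y : GrpdLimit F} (h : x = y) (j : J) :
    Hom.app (eqToHom h : x ⟶ y) j = eqToHom (by rw [h]) := by
  subst h; rfl

variable (F)

theorem eq_conj {C : Type u} [Category.{v} C] {X Y X' Y' : C} (a : X ⟶ Y) (b : X' ⟶ Y')
    (h₁ : X' = X) (h₂ : Y = Y') (h : b = eqToHom h₁ ≫ a ≫ eqToHom h₂) (h₃ : X = X')
    (h₄ : Y' = Y) : a = eqToHom h₃ ≫ b ≫ eqToHom h₄ := by
  subst h₁ h₂ h; simp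

/-- The projections of the explicit limit. -/
def proj (j : J) : GrpdLimit F ⥤ F.obj j where
  obj x := x.obj j
  map a := Hom.app a j
  map_id _ := rfl
  map_comp _ _ := rfl

/-- The explicit limit cone. -/
def cone : Cone F where
  pt := Grpd.of (GrpdLimit F)
  π :=
    { app := fun j => (proj F j : GrpdLimit F ⥤ F.obj j)
      naturality := fun i j f => by
        refine CategoryTheory.Functor.ext (fun x => (x.compat f).symm) (fun x y a => ?_)
        exact eq_conj _ _ _ _ (Hom.compat a f) _ _ }

/-- The functor into the explicit limit given by a cone. -/
def lift (s : Cone F) : s.pt ⥤ GrpdLimit F where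
  obj x := ⟨fun j => (s.π.app j).obj x, fun f => Functor.congr_obj (s.w f) x⟩
  map a := ⟨fun j => (s.π.app j).map a, fun f => Functor.congr_hom (s.w f) a⟩
  map_id x := hom_ext fun j => (s.π.app j).map_id x
  map_comp a b := hom_ext fun j => (s.π.app j).map_comp a b

/-- The explicit cone is a limit cone. -/
def isLimit : IsLimit (cone F) where
  lift s := lift F s
  fac s j := rfl
  uniq s m w := by
    have h (x : s.pt) : (show s.pt ⥤ GrpdLimit F from m).obj x = (lift F s).obj x :=
      obj_ext fun j => Functor.congr_obj (w j) x
    refine CategoryTheory.Functor.ext h (fun x y a => hom_ext fun j => ?_)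
    refine (Functor.congr_hom (w j) a).trans ?_
    exact congrArg₂ (fun p q => p ≫ (s.π.app j).map a ≫ q) (eqToHom_app (h x) j).symm
      (eqToHom_app (h y).symm j).symm

end GrpdLimit

instance grpd_hasLimits : HasLimitsOfSize.{0, 0} Grpd.{v, u} where
  has_limits_of_shape _ _ := ⟨fun F => ⟨⟨⟨GrpdLimit.cone F, GrpdLimit.isLimit F⟩⟩⟩⟩

end GrpdLimits

/-! ## The canonical model structure on groupoids: weak equivalences and fibrations -/

/-- An isofibration: every isomorphism out of the image of an object lifts. -/
def IsIsofibration {X Y : Grpd.{v, u}} (G : X ⟶ Y) : Prop :=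
  ∀ (x : X) (y : Y) (e : G.obj x ⟶ y), ∃ (x' : X) (e' : x ⟶ x') (h : G.obj x' = y),
    G.map e' ≫ eqToHom h = e

/-- A map of simplicial groupoids which is an equivalence of groupoids in each degree. -/
def LevelwiseWeakEquivalence {X Y : SimplexCategoryᵒᵖ ⥤ Grpd.{v, u}} (w : X ⟶ Y) : Prop :=
  ∀ n, Functor.IsEquivalence (w.app n)

/-- A map of simplicial groupoids which is an equivalence and an isofibration in each degree. -/
def LevelwiseAcyclicFibration {X Y : SimplexCategoryᵒᵖ ⥤ Grpd.{v, u}} (w : X ⟶ Y) : Prop :=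
  ∀ n, Functor.IsEquivalence (w.app n) ∧ IsIsofibration (w.app n)

/-! ## Exact categories -/

section Exact

/-- `i` is an admissible monomorphism for the family `S` if it is the first map of a sequence
in `S`. -/
def admMono {A : Type u} [Category.{v} A] [Preadditive A] (S : ObjectProperty (ShortComplex A)) :
    MorphismProperty A :=
  fun _ Y i => ∃ (Z : A) (p : Y ⟶ Z) (w : i ≫ p = 0), S (ShortComplex.mk i p w)

/-- `p` is an admissible epimorphism for the family `S` if it is the second map of a sequence
in `S`. -/
def admEpi {A : Type u} [Category.{v} A] [Preadditive A] (S : ObjectProperty (ShortComplex A)) :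
    MorphismProperty A :=
  fun Y _ p => ∃ (X : A) (i : X ⟶ Y) (w : i ≫ p = 0), S (ShortComplex.mk i p w)

/-- An exact category: an additive category with a family of kernel-cokernel pairs, satisfying
the axioms of Quillen in Keller's form. -/
class ExactCategory (A : Type u) [Category.{v} A] [Preadditive A] [HasFiniteBiproducts A] where
  /-- the family of exact sequences -/
  seq : ObjectProperty (ShortComplex A)
  isKernel : ∀ S : ShortComplex A, seq S → Nonempty (IsLimit (KernelFork.ofι S.f S.zero))
  isCokernel : ∀ S : ShortComplex A, seq S → Nonempty (IsColimit (CokernelCofork.ofπ S.g S.zero))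
  of_iso : ∀ {S T : ShortComplex A}, (S ≅ T) → seq S → seq T
  admEpi_id_zero : ∀ Z : A, IsZero Z → admEpi seq (𝟙 Z)
  admEpi_comp : ∀ {X Y Z : A} (p : X ⟶ Y) (q : Y ⟶ Z),
    admEpi seq p → admEpi seq q → admEpi seq (p ≫ q)
  pullback : ∀ {C C' B' : A} (f : C ⟶ C') (p' : B' ⟶ C'), admEpi seq p' →
    ∃ (B : A) (g : B ⟶ B') (p : B ⟶ C), IsPullback g p p' f ∧ admEpi seq p
  pushout : ∀ {X X' Y : A} (g : X ⟶ X') (i : X ⟶ Y), admMono seq i →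
    ∃ (Y' : A) (h : Y ⟶ Y') (i' : X' ⟶ Y'), IsPushout i g h i' ∧ admMono seq i'

variable {A : Type u} [Category.{v} A] [Preadditive A] [HasFiniteBiproducts A] [ExactCategory A]
variable {B : Type u} [Category.{v} B] [Preadditive B] [HasFiniteBiproducts B] [ExactCategory B]

variable (A) in
/-- The admissible monomorphisms of an exact category. -/
abbrev M : MorphismProperty A := admMono (ExactCategory.seq (A := A))

variable (A) in
/-- The admissible epimorphisms of an exact category. -/
abbrev E : MorphismProperty A := admEpi (ExactCategory.seq (A := A))

/-- An exact functor: an additive functor which preserves exact sequences. -/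
class IsExactFunctor (f : A ⥤ B) [f.Additive] : Prop where
  map_seq : ∀ S : ShortComplex A, ExactCategory.seq S → ExactCategory.seq (S.map f)

/-- A square which is both a pullback and a pushout. -/
def Bicartesian {C : Type u} [Category.{v} C] {X Y Z W : C} (a : X ⟶ Y) (b : X ⟶ Z) (c : Y ⟶ W)
    (d : Z ⟶ W) : Prop :=
  IsPullback a b c d ∧ IsPushout a b c d

theorem seq_of_isZero (S : ShortComplex A) (h₁ : IsZero S.X₁) (h₂ : IsZero S.X₂)
    (h₃ : IsZero S.X₃) : ExactCategory.seq S := by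
  obtain ⟨K, i, w, h⟩ := ExactCategory.admEpi_id_zero _ h₂
  obtain ⟨l⟩ := ExactCategory.isKernel _ h
  have : Mono i := Fork.IsLimit.mono l
  have hK : IsZero K := IsZero.of_mono i h₂
  exact ExactCategory.of_iso (S := ShortComplex.mk i (𝟙 S.X₂) w) (T := S)
    (ShortComplex.isoMk (hK.iso h₁) (Iso.refl S.X₂) (h₂.iso h₃)
      (hK.eq_of_src _ _) (h₂.eq_of_src _ _)) h

theorem M_map (f : A ⥤ B) [f.Additive] [IsExactFunctor f] {X Y : A} (i : X ⟶ Y) (h : M A i) :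
    M B (f.map i) := by
  obtain ⟨Z, p, w, h⟩ := h
  exact ⟨f.obj Z, f.map p, by rw [← f.map_comp, w, f.map_zero], IsExactFunctor.map_seq _ h⟩

theorem E_map (f : A ⥤ B) [f.Additive] [IsExactFunctor f] {X Y : A} (i : X ⟶ Y) (h : E A i) :
    E B (f.map i) := by
  obtain ⟨Z, p, w, h⟩ := h
  exact ⟨f.obj Z, f.map p, by rw [← f.map_comp, w, f.map_zero], IsExactFunctor.map_seq _ h⟩

/-- A commutative square whose rows have the same cokernel and whose columns have the same
kernel is bicartesian. -/
theorem bicartesian_of_seq {X Y Z W K Q : A} {a : X ⟶ Y} {b : X ⟶ Z} {c : Y ⟶ W} {d : Z ⟶ W}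
    {k : K ⟶ X} {r : W ⟶ Q} (sq : a ≫ c = b ≫ d)
    (w₁ : k ≫ b = 0) (h₁ : ExactCategory.seq (ShortComplex.mk k b w₁))
    (w₂ : (k ≫ a) ≫ c = 0) (h₂ : ExactCategory.seq (ShortComplex.mk (k ≫ a) c w₂))
    (w₃ : a ≫ (c ≫ r) = 0) (h₃ : ExactCategory.seq (ShortComplex.mk a (c ≫ r) w₃))
    (w₄ : d ≫ r = 0) (h₄ : ExactCategory.seq (ShortComplex.mk d r w₄)) :
    Bicartesian a b c d := by
  obtain ⟨l₃⟩ := ExactCategory.isKernel _ h₃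
  obtain ⟨l₄⟩ := ExactCategory.isKernel _ h₄
  obtain ⟨l₁⟩ := ExactCategory.isCokernel _ h₁
  obtain ⟨l₂⟩ := ExactCategory.isCokernel _ h₂
  have : Mono a := Fork.IsLimit.mono l₃
  have : Mono d := Fork.IsLimit.mono l₄
  have : Epi b := Cofork.IsColimit.epi l₁
  have : Epi c := Cofork.IsColimit.epi l₂
  refine ⟨⟨⟨sq⟩, ⟨PullbackCone.IsLimit.mk _ (fun s => (KernelFork.IsLimit.lift' l₃ s.fst ?_).1)
    (fun s => ?_) (fun s => ?_) (fun s m h _ => ?_)⟩⟩,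
    ⟨⟨sq⟩, ⟨PushoutCocone.IsColimit.mk _ (fun s => (CokernelCofork.IsColimit.desc' l₂ s.inl ?_).1)
    (fun s => ?_) (fun s => ?_) (fun s m h _ => ?_)⟩⟩⟩
  · rw [← Category.assoc]
    change (s.fst ≫ c) ≫ r = 0
    rw [s.condition, Category.assoc, w₄, comp_zero]
  · exact (KernelFork.IsLimit.lift' l₃ s.fst _).2
  · rw [← cancel_mono d, Category.assoc, ← sq, ← Category.assoc]
    refine Eq.trans ?_ s.condition
    exact congrArg (· ≫ c) (KernelFork.IsLimit.lift' l₃ s.fst _).2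
  · rw [← cancel_mono a, h]
    exact (KernelFork.IsLimit.lift' l₃ s.fst _).2.symm
  · change (k ≫ a) ≫ s.inl = 0
    rw [Category.assoc, s.condition, ← Category.assoc, w₁, zero_comp]
  · exact (CokernelCofork.IsColimit.desc' l₂ s.inl _).2
  · rw [← cancel_epi b, ← Category.assoc, ← sq, Category.assoc]
    refine Eq.trans ?_ s.condition
    exact congrArg (a ≫ ·) (CokernelCofork.IsColimit.desc' l₂ s.inl _).2
  · rw [← cancel_epi c, h]
    exact (CokernelCofork.IsColimit.desc' l₂ s.inl _).2.symm

/-- Exact functors preserve the bicartesian squares of exact nerves. -/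
theorem Bicartesian.map (f : A ⥤ B) [f.Additive] [IsExactFunctor f] {X Y Z W : A} {a : X ⟶ Y}
    {b : X ⟶ Z} {c : Y ⟶ W} {d : Z ⟶ W} (h : Bicartesian a b c d) (ha : M A a) (hb : E A b)
    (hc : E A c) (hd : M A d) : Bicartesian (f.map a) (f.map b) (f.map c) (f.map d) := by
  obtain ⟨hl, hr⟩ := h
  obtain ⟨K, k, w₁, h₁⟩ := hb
  obtain ⟨Q, r, w₄, h₄⟩ := hd
  obtain ⟨K', k', w₂, h₂⟩ := hc
  obtain ⟨Q', r', w₃, h₃⟩ := ha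
  have w₂' : (k ≫ a) ≫ c = 0 := by rw [Category.assoc, hl.w, ← Category.assoc, w₁, zero_comp]
  have w₃' : a ≫ (c ≫ r) = 0 := by
    rw [← Category.assoc, hl.w, Category.assoc, w₄, comp_zero]
  have h₂' : ExactCategory.seq (ShortComplex.mk (k ≫ a) c w₂') := by
    obtain ⟨l₁⟩ := ExactCategory.isKernel _ h₁
    obtain ⟨l₂⟩ := ExactCategory.isKernel _ h₂
    have : Mono k := Fork.IsLimit.mono l₁
    have : Mono k' := Fork.IsLimit.mono l₂
    obtain ⟨s, hs⟩ := KernelFork.IsLimit.lift' l₂ (k ≫ a) w₂'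
    have e : k' ≫ c = (0 : K' ⟶ Z) ≫ d := by rw [w₂, zero_comp]
    obtain ⟨t, ht⟩ := KernelFork.IsLimit.lift' l₁ (hl.lift k' 0 e) (hl.lift_snd _ _ _)
    change s ≫ k' = k ≫ a at hs
    change t ≫ k = _ at ht
    have hts : t ≫ s = 𝟙 K' := by
      rw [← cancel_mono k', Category.assoc, hs, ← Category.assoc, ht, hl.lift_fst,
        Category.id_comp]
    have hst : s ≫ t = 𝟙 K := by
      rw [← cancel_mono k, Category.assoc, ht, Category.id_comp]
      apply hl.hom_ext
      · rw [Category.assoc, hl.lift_fst, hs]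
      · rw [Category.assoc, hl.lift_snd, comp_zero, w₁]
    refine ExactCategory.of_iso (S := ShortComplex.mk k' c w₂) (ShortComplex.isoMk
      (show K' ≅ K from ⟨t, s, hts, hst⟩) (Iso.refl Y) (Iso.refl W) ?_ ?_) h₂
    · change t ≫ k ≫ a = k' ≫ 𝟙 Y
      rw [← Category.assoc, ht, hl.lift_fst, Category.comp_id]
    · change 𝟙 Y ≫ c = c ≫ 𝟙 W
      rw [Category.comp_id, Category.id_comp]
  have h₃' : ExactCategory.seq (ShortComplex.mk a (c ≫ r) w₃') := by
    obtain ⟨l₄⟩ := ExactCategory.isCokernel _ h₄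
    obtain ⟨l₃⟩ := ExactCategory.isCokernel _ h₃
    have : Epi r := Cofork.IsColimit.epi l₄
    have : Epi r' := Cofork.IsColimit.epi l₃
    obtain ⟨s, hs⟩ := CokernelCofork.IsColimit.desc' l₃ (c ≫ r) w₃'
    have e : a ≫ r' = b ≫ (0 : Z ⟶ Q') := by rw [w₃, comp_zero]
    obtain ⟨t, ht⟩ := CokernelCofork.IsColimit.desc' l₄ (hr.desc r' 0 e) (hr.inr_desc _ _ _)
    change r' ≫ s = c ≫ r at hs
    change r ≫ t = _ at ht
    have hst : s ≫ t = 𝟙 Q' := by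
      rw [← cancel_epi r', ← Category.assoc, hs, Category.assoc, ht, hr.inl_desc,
        Category.comp_id]
    have hts : t ≫ s = 𝟙 Q := by
      rw [← cancel_epi r, ← Category.assoc, ht, Category.comp_id]
      apply hr.hom_ext
      · rw [← Category.assoc, hr.inl_desc, hs]
      · rw [← Category.assoc, hr.inr_desc, zero_comp, w₄]
    refine ExactCategory.of_iso (S := ShortComplex.mk a r' w₃) (ShortComplex.isoMk
      (Iso.refl X) (Iso.refl Y) (show Q' ≅ Q from ⟨s, t, hst, hts⟩) ?_ ?_) h₃
    · change 𝟙 X ≫ a = a ≫ 𝟙 Y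
      rw [Category.comp_id, Category.id_comp]
    · change 𝟙 Y ≫ c ≫ r = r' ≫ s
      rw [Category.id_comp, hs]
  refine bicartesian_of_seq (k := f.map k) (r := f.map r) ?_ ?_ ?_ ?_ ?_ ?_ ?_ ?_ ?_
  · rw [← f.map_comp, hl.w, f.map_comp]
  · rw [← f.map_comp, w₁, f.map_zero]
  · exact IsExactFunctor.map_seq _ h₁
  · rw [← f.map_comp, ← f.map_comp, w₂', f.map_zero]
  · have := IsExactFunctor.map_seq (f := f) _ h₂'
    simpa only [ShortComplex.map, Functor.map_comp] using this
  · rw [← f.map_comp, ← f.map_comp, w₃', f.map_zero]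
  · have := IsExactFunctor.map_seq (f := f) _ h₃'
    simpa only [ShortComplex.map, Functor.map_comp] using this
  · rw [← f.map_comp, w₄, f.map_zero]
  · exact IsExactFunctor.map_seq _ h₄

end Exact

/-! ## Index categories -/

abbrev DeltaSq : Type := SimplexCategory × SimplexCategory

/-- The category `Δ × Δ` with a new terminal object `[-1]` added. -/
abbrev SigmaCat : Type := WithTerminal DeltaSq

/-- The ordinal sum of two monotone maps. -/
def joinHom {m m' n n' : SimplexCategory} (f : m ⟶ m') (g : n ⟶ n') :
    (⦋m.len + n.len + 1⦌ : SimplexCategory) ⟶ ⦋m'.len + n'.len + 1⦌ :=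
  SimplexCategory.mkHom
    { toFun := fun i =>
        if h : i.val ≤ m.len then
          ⟨(f.toOrderHom ⟨i.val, by omega⟩).val, by omega⟩
        else
          ⟨m'.len + 1 + (g.toOrderHom ⟨i.val - (m.len + 1), by omega⟩).val, by omega⟩
      monotone' := fun a b hab => by
        have hab' : a.val ≤ b.val := hab
        by_cases ha : a.val ≤ m.len <;> by_cases hb : b.val ≤ m.len
        · simpa [ha, hb] using f.toOrderHom.monotone (Fin.mk_le_mk.2 hab')
        · simp only [ha, hb, dite_true, dite_false, Fin.mk_le_mk]
          omega
        · omega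
        · simp only [ha, hb, dite_false, Fin.mk_le_mk]
          have := g.toOrderHom.monotone (a := ⟨a.val - (m.len + 1), by omega⟩)
            (b := ⟨b.val - (m.len + 1), by omega⟩) (Fin.mk_le_mk.2 (by omega))
          have : (g.toOrderHom ⟨a.val - (m.len + 1), by omega⟩).val ≤
            (g.toOrderHom ⟨b.val - (m.len + 1), by omega⟩).val := this
          omega }

theorem joinHom_left {m m' n n' : SimplexCategory} (f : m ⟶ m') (g : n ⟶ n')
    (i : Fin (m.len + n.len + 1 + 1)) (a : Fin (m.len + 1)) (h : i.val = a.val) :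
    ((joinHom f g).toOrderHom i).val = (f.toOrderHom a).val := by
  obtain ⟨i, hi⟩ := i
  obtain ⟨a, ha⟩ := a
  subst h
  change Fin.val (dite _ _ _) = _
  rw [dif_pos (Nat.lt_succ_iff.1 ha)]

theorem joinHom_right {m m' n n' : SimplexCategory} (f : m ⟶ m') (g : n ⟶ n')
    (i : Fin (m.len + n.len + 1 + 1)) (b : Fin (n.len + 1)) (h : i.val = m.len + 1 + b.val) :
    ((joinHom f g).toOrderHom i).val = m'.len + 1 + (g.toOrderHom b).val := by
  obtain ⟨i, hi⟩ := i
  obtain ⟨b, hb⟩ := b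
  subst h
  change Fin.val (dite _ _ _) = _
  rw [dif_neg (show ¬ m.len + 1 + b ≤ m.len by omega)]
  simp only [Nat.add_sub_cancel_left]

/-- Every vertex of `[m + 1 + n]` lies either in `[m]` or in `[n]`. -/
theorem join_cases (m n : ℕ) (i : Fin (m + n + 1 + 1)) :
    (∃ a : Fin (m + 1), i.val = a.val) ∨ ∃ b : Fin (n + 1), i.val = m + 1 + b.val := by
  by_cases h : i.val ≤ m
  · exact Or.inl ⟨⟨i.val, by omega⟩, rfl⟩
  · exact Or.inr ⟨⟨i.val - (m + 1), by omega⟩, by simp only; omega⟩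

theorem hom_ext_val {m n : SimplexCategory} {f g : m ⟶ n}
    (h : ∀ i, (f.toOrderHom i).val = (g.toOrderHom i).val) : f = g :=
  SimplexCategory.Hom.ext _ _ (OrderHom.ext _ _ (funext fun i => Fin.ext (h i)))

theorem joinHom_id (m n : SimplexCategory) :
    joinHom (𝟙 m) (𝟙 n) = 𝟙 (⦋m.len + n.len + 1⦌ : SimplexCategory) :=
  hom_ext_val fun i => by
    obtain ⟨a, ha⟩ | ⟨b, hb⟩ := join_cases m.len n.len i
    · exact (joinHom_left _ _ i a ha).trans ha.symm
    · exact (joinHom_right _ _ i b hb).trans hb.symm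

theorem joinHom_comp {m m' m'' n n' n'' : SimplexCategory} (f : m ⟶ m') (f' : m' ⟶ m'')
    (g : n ⟶ n') (g' : n' ⟶ n'') :
    joinHom (f ≫ f') (g ≫ g') = joinHom f g ≫ joinHom f' g' :=
  hom_ext_val fun i => by
    obtain ⟨a, ha⟩ | ⟨b, hb⟩ := join_cases m.len n.len i
    · exact (joinHom_left _ _ i a ha).trans
        (joinHom_left f' g' _ (f.toOrderHom a) (joinHom_left f g i a ha)).symm
    · exact (joinHom_right _ _ i b hb).trans
        (joinHom_right f' g' _ (g.toOrderHom b) (joinHom_right f g i b hb)).symm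

/-- The ordinal sum, on objects `([m], [n]) ↦ [m + 1 + n]`. -/
def join : DeltaSq ⥤ SimplexCategory where
  obj x := ⦋x.1.len + x.2.len + 1⦌
  map g := joinHom g.1 g.2
  map_id x := joinHom_id x.1 x.2
  map_comp f g := joinHom_comp f.1 g.1 f.2 g.2

/-- The extension `p : Σ ⥤ Δ` of the ordinal sum which sends `[-1]` to `[0]`. -/
def p : SigmaCat ⥤ SimplexCategory :=
  WithTerminal.liftToTerminal join SimplexCategory.isTerminalZero

/-- Join with an initial object, `[n] ↦ [0] ⋆ [n]`. -/
def j : SimplexCategory ⥤ SimplexCategory :=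
  Prod.sectR ⦋0⦌ SimplexCategory ⋙ join

/-- The inclusion `[n] ⟶ [0] ⋆ [n]`, which omits the initial vertex. -/
def inclJ (n : SimplexCategory) : n ⟶ (⦋0 + n.len + 1⦌ : SimplexCategory) :=
  SimplexCategory.mkHom (n := n.len)
    { toFun := fun i => ⟨i.val + 1, by omega⟩
      monotone' := fun a b h => by
        have : a.val ≤ b.val := h
        simpa using this }

/-- The inclusions `[n] ⟶ [0] ⋆ [n]` are natural. -/
def toJ : 𝟭 SimplexCategory ⟶ j where
  app n := inclJ n
  naturality m _ f := hom_ext_val fun i =>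
    (Nat.add_comm _ _).trans (joinHom_right (𝟙 (⦋0⦌ : SimplexCategory)) f
      ((inclJ m).toOrderHom i) i (Nat.add_comm _ _)).symm

/-- The identification `([0] ⋆ [k]) ⋆ [l] = [0] ⋆ ([k] ⋆ [l])`. -/
def assocHom (k l : SimplexCategory) :
    (⦋0 + k.len + 1 + l.len + 1⦌ : SimplexCategory) ⟶ ⦋0 + (k.len + l.len + 1) + 1⦌ :=
  SimplexCategory.mkHom
    { toFun := fun i => ⟨i.val, by omega⟩
      monotone' := fun _ _ h => h }

theorem assocHom_naturality {k k' l l' : SimplexCategory} (f : k ⟶ k') (g : l ⟶ l') :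
    joinHom (joinHom (𝟙 (⦋0⦌ : SimplexCategory)) f) g ≫ assocHom k' l' =
      assocHom k l ≫ joinHom (𝟙 (⦋0⦌ : SimplexCategory)) (joinHom f g) :=
  hom_ext_val fun i => by
    change ((joinHom (joinHom (𝟙 (⦋0⦌ : SimplexCategory)) f) g).toOrderHom i).val =
      ((joinHom (𝟙 (⦋0⦌ : SimplexCategory)) (joinHom f g)).toOrderHom
        ((assocHom k l).toOrderHom i)).val
    obtain ⟨a, ha⟩ | ⟨b, hb⟩ := join_cases (0 + k.len + 1) l.len i
    · refine (joinHom_left (joinHom (𝟙 (⦋0⦌ : SimplexCategory)) f) g i a ha).trans ?_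
      obtain ⟨c, hc⟩ | ⟨c, hc⟩ := join_cases 0 k.len a
      · exact (joinHom_left (𝟙 (⦋0⦌ : SimplexCategory)) f a c hc).trans
          (joinHom_left (𝟙 (⦋0⦌ : SimplexCategory)) (joinHom f g) _ c (ha.trans hc)).symm
      · refine (joinHom_right (𝟙 (⦋0⦌ : SimplexCategory)) f a c hc).trans ?_
        refine Eq.trans ?_ (joinHom_right (𝟙 (⦋0⦌ : SimplexCategory)) (joinHom f g) _
          (⟨c.val, by omega⟩ : Fin (k.len + l.len + 1 + 1)) (ha.trans hc)).symm
        exact congrArg (0 + 1 + ·) (joinHom_left f g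
          (⟨c.val, by omega⟩ : Fin (k.len + l.len + 1 + 1)) c rfl).symm
    · refine (joinHom_right (joinHom (𝟙 (⦋0⦌ : SimplexCategory)) f) g i b hb).trans ?_
      refine Eq.trans ?_ (joinHom_right (𝟙 (⦋0⦌ : SimplexCategory)) (joinHom f g) _
          (⟨k.len + 1 + b.val, by omega⟩ : Fin (k.len + l.len + 1 + 1))
          (hb.trans (by change 0 + k.len + 1 + 1 + b.val = 0 + 1 + (k.len + 1 + b.val); omega))).symm
      refine Eq.trans ?_ (congrArg (0 + 1 + ·) (joinHom_right f g
          (⟨k.len + 1 + b.val, by omega⟩ : Fin (k.len + l.len + 1 + 1)) b rfl).symm)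
      change 0 + k'.len + 1 + 1 + _ = 0 + 1 + (k'.len + 1 + _)
      omega

theorem joinHom_inclJ (k l : SimplexCategory) :
    joinHom (inclJ k) (𝟙 l) ≫ assocHom k l = inclJ ⦋k.len + l.len + 1⦌ :=
  hom_ext_val fun i => by
    change ((joinHom (inclJ k) (𝟙 l)).toOrderHom i).val = i.val + 1
    obtain ⟨a, ha⟩ | ⟨b, hb⟩ := join_cases k.len l.len i
    · exact (joinHom_left _ _ i a ha).trans (congrArg (· + 1) ha.symm)
    · refine (joinHom_right _ _ i b hb).trans ?_
      rw [hb]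
      change 0 + k.len + 1 + 1 + b.val = _
      omega

/-- The associativity of the join, as a natural transformation. -/
def assocJ : j.prod (𝟭 SimplexCategory) ⋙ join ⟶ join ⋙ j where
  app x := assocHom x.1 x.2
  naturality _ _ f := assocHom_naturality f.1 f.2

/-- The object `(0, 0)` of `Δ × Δ`. -/
abbrev zz : DeltaSq := (⦋0⦌, ⦋0⦌)

/-- The object `(0, 0)` is terminal in `Δ × Δ`. -/
def zzTerminal : IsTerminal zz :=
  IsTerminal.ofUniqueHom
    (fun x => (SimplexCategory.isTerminalZero.from x.1, SimplexCategory.isTerminalZero.from x.2))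
    (fun _ _ => Prod.ext (SimplexCategory.isTerminalZero.hom_ext _ _)
      (SimplexCategory.isTerminalZero.hom_ext _ _))

/-! ## Preaugmented bisimplicial objects -/

section Preaug

universe w' w

/-- Preaugmented bisimplicial objects. -/
abbrev Preaug (C : Type w) [Category.{w'} C] : Type _ := SigmaCatᵒᵖ ⥤ C

variable {C : Type w} [Category.{w'} C]

namespace Preaug

/-- The underlying bisimplicial object. -/
abbrev under (Y : Preaug C) : DeltaSqᵒᵖ ⥤ C := WithTerminal.incl.op ⋙ Y

/-- The augmentation `Y_{-1}`. -/
abbrev augObj (Y : Preaug C) : C := Y.obj (op WithTerminal.star)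

/-- The augmentation map `Y_{-1} ⟶ Y_{0,0}`. -/
abbrev aug (Y : Preaug C) : Y.augObj ⟶ Y.under.obj (op zz) :=
  Y.map (WithTerminal.homFrom zz).op

/-- The preaugmented bisimplicial object given by a bisimplicial object `Y` and a map
`Z ⟶ Y_{0,0}`. -/
def mk (Y : DeltaSqᵒᵖ ⥤ C) (Z : C) (ε : Z ⟶ Y.obj (op zz)) : Preaug C :=
  (WithTerminal.lift (Z := op Z) Y.rightOp (fun x => (ε ≫ Y.map (zzTerminal.from x).op).op)
    (fun x y g => by
      change (((ε ≫ Y.map (zzTerminal.from y).op) ≫ Y.map g.op)).op = _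
      rw [Category.assoc, ← Y.map_comp, ← op_comp, zzTerminal.hom_ext (g ≫ _) _])).leftOp

theorem mk_aug (Y : DeltaSqᵒᵖ ⥤ C) (Z : C) (ε : Z ⟶ Y.obj (op zz)) : (mk Y Z ε).aug = ε := by
  change ε ≫ Y.map (zzTerminal.from zz).op = ε
  rw [zzTerminal.hom_ext (zzTerminal.from zz) (𝟙 zz), op_id, Y.map_id, Category.comp_id]

theorem map_star (Y : Preaug C) {y : DeltaSq} (g : WithTerminal.of y ⟶ WithTerminal.star) :
    Y.map g.op = Y.aug ≫ Y.under.map (zzTerminal.from y).op := by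
  have h : g = WithTerminal.incl.map (zzTerminal.from y) ≫ WithTerminal.homFrom zz :=
    Subsingleton.elim _ _
  exact (congrArg (fun g => Y.map (Quiver.Hom.op g)) h).trans (Y.map_comp _ _)

/-- A map of preaugmented bisimplicial objects is given by a map of bisimplicial objects and a
compatible map of augmentations. -/
def homMk {Y Y' : Preaug C} (α : Y.under ⟶ Y'.under) (ζ : Y.augObj ⟶ Y'.augObj)
    (h : Y.aug ≫ α.app (op zz) = ζ ≫ Y'.aug) : Y ⟶ Y' where
  app x := match x with
    | ⟨WithTerminal.of y⟩ => α.app (op y)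
    | ⟨WithTerminal.star⟩ => ζ
  naturality x y g := by
    obtain ⟨x⟩ := x
    obtain ⟨y⟩ := y
    obtain ⟨g, rfl⟩ : ∃ g' : y ⟶ x, g = g'.op := ⟨g.unop, rfl⟩
    match x, y, g with
    | .of x, .of y, g => exact α.naturality (Quiver.Hom.op (WithTerminal.down g))
    | .star, .star, g =>
      obtain rfl : g = 𝟙 _ := Subsingleton.elim _ _
      change Y.map (𝟙 _) ≫ ζ = ζ ≫ Y'.map (𝟙 _)
      rw [Y.map_id, Y'.map_id, Category.id_comp, Category.comp_id]
    | .star, .of y, g =>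
      rw [map_star Y g, map_star Y' g]
      refine (Category.assoc _ _ _).trans ?_
      refine (congrArg (Y.aug ≫ ·) (α.naturality (zzTerminal.from y).op)).trans ?_
      refine (Category.assoc _ _ _).symm.trans ?_
      exact (congrArg (· ≫ Y'.under.map (zzTerminal.from y).op) h).trans (Category.assoc _ _ _)
    | .of x, .star, g => exact (WithTerminal.false_of_from_star g).elim

variable [HasLimitsOfSize.{0, 0} C]

/-- The augmentation `Y_{1,0} ×_{Y_{0,0}} Y_{-1}` of the initial path construction. -/
noncomputable abbrev pathAug (Y : Preaug C) : C :=
  pullback (Y.under.map (Quiver.Hom.op (show zz ⟶ ((j.prod (𝟭 _)).obj zz) from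
    (toJ.app ⦋0⦌, 𝟙 _)))) Y.aug

/-- The initial path construction of a preaugmented bisimplicial object. -/
noncomputable def path (Y : Preaug C) : Preaug C :=
  mk ((j.prod (𝟭 SimplexCategory)).op ⋙ Y.under) Y.pathAug (pullback.fst _ _)

/-- The map `d₀ : P Y ⟶ Y` from the initial path construction. -/
noncomputable def pathD₀ (Y : Preaug C) : Y.path ⟶ Y :=
  homMk
    { app := fun x => Y.under.map (Quiver.Hom.op (show x.unop ⟶ (j.prod (𝟭 _)).obj x.unop from
        (toJ.app x.unop.1, 𝟙 _)))
      naturality := fun x y g => by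
        refine (Y.under.map_comp _ _).symm.trans (Eq.trans ?_ (Y.under.map_comp _ _))
        refine congrArg (fun t => Y.under.map (Quiver.Hom.op t)) ?_
        exact Prod.ext (toJ.naturality g.unop.1).symm
          ((Category.id_comp _).trans (Category.comp_id _).symm) }
    (pullback.snd _ _)
    ((congrArg (· ≫ _) (mk_aug _ _ _)).trans pullback.condition)

end Preaug

variable [HasLimitsOfSize.{0, 0} C]

variable (C) in
/-- The generalized `S_•`-construction: the right adjoint `p_*` of `p^*`, given by right Kan
extension along `p`. -/
noncomputable abbrev genS : Preaug C ⥤ (SimplexCategoryᵒᵖ ⥤ C) := p.op.ran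

variable (C) in
/-- The initial path object of a simplicial object, as a functor. -/
abbrev path : (SimplexCategoryᵒᵖ ⥤ C) ⥤ (SimplexCategoryᵒᵖ ⥤ C) :=
  (Functor.whiskeringLeft _ _ C).obj j.op

/-- The map `d₀ : P X ⟶ X` from the initial path object. -/
def pathD₀ (X : SimplexCategoryᵒᵖ ⥤ C) : (path C).obj X ⟶ X where
  app n := X.map (toJ.app n.unop).op
  naturality m n g := by
    refine (X.map_comp _ _).symm.trans (Eq.trans ?_ (X.map_comp _ _))
    exact congrArg (fun t => X.map (Quiver.Hom.op t)) (toJ.naturality g.unop).symm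

/-- The map `p^* P (S Y) ⟶ P Y` which is adjoint to `P (S Y) ⟶ S (P Y)`. In degree `(k, l)` it is
the projection of `(S Y)_{1 + (k + 1 + l)} = (S Y)_{(1 + k) + 1 + l}` to `Y_{1 + k, l}`; in degree
`-1` it sends `(S Y)_1` to the pair of its components in `Y_{1,0}`, at the vertices `0 ≤ 1 ≤ 1`
of `[1]`, and in `Y_{-1}`, at the vertex `1`. -/
noncomputable def pathComparisonAdj (Y : Preaug C) :
    p.op ⋙ (path C).obj ((genS C).obj Y) ⟶ Y.path :=
  Preaug.homMk
    { app := fun x => ((genS C).obj Y).map (assocJ.app x.unop).op ≫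
        (p.op.ranCounit.app Y).app (op (WithTerminal.of ((j.prod (𝟭 _)).obj x.unop)))
      naturality := fun x y g => by
        refine (Category.assoc _ _ _).symm.trans ?_
        refine Eq.trans ?_ (congrArg (((genS C).obj Y).map (assocJ.app x.unop).op ≫ ·)
          ((p.op.ranCounit.app Y).naturality
            (WithTerminal.incl.map ((j.prod (𝟭 _)).map g.unop)).op) |>.trans
              (Category.assoc _ _ _).symm)
        refine Eq.trans ?_ (Category.assoc _ _ _)
        refine congrArg (· ≫ _) ?_
        refine (((genS C).obj Y).map_comp _ _).symm.trans
          (Eq.trans ?_ (((genS C).obj Y).map_comp _ _))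
        exact congrArg (fun t => ((genS C).obj Y).map (Quiver.Hom.op t))
          (assocJ.naturality g.unop).symm }
    (pullback.lift
      (((genS C).obj Y).map (assocJ.app zz ≫ j.map (p.map (WithTerminal.homFrom zz))).op ≫
        (p.op.ranCounit.app Y).app (op (WithTerminal.of ((j.prod (𝟭 _)).obj zz))))
      (((genS C).obj Y).map (toJ.app ⦋0⦌).op ≫
        (p.op.ranCounit.app Y).app (op WithTerminal.star))
      (by
        have e : joinHom (toJ.app (⦋0⦌ : SimplexCategory)) (𝟙 (⦋0⦌ : SimplexCategory)) ≫
            assocJ.app zz ≫ j.map (p.map (WithTerminal.homFrom zz)) =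
            p.map (WithTerminal.homFrom zz) ≫ toJ.app ⦋0⦌ := by
          refine Eq.trans ?_ (toJ.naturality (p.map (WithTerminal.homFrom zz))).symm
          refine (Category.assoc _ _ _).symm.trans (congrArg (· ≫ _) ?_)
          exact joinHom_inclJ _ _
        refine (Category.assoc _ _ _).trans ?_
        refine Eq.trans ?_ (Category.assoc _ _ _).symm
        refine (congrArg (_ ≫ ·) ((p.op.ranCounit.app Y).naturality (Quiver.Hom.op
          (WithTerminal.incl.map (show zz ⟶ ((j.prod (𝟭 _)).obj zz) from
            (toJ.app ⦋0⦌, 𝟙 _))))).symm).trans ?_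
        refine Eq.trans ?_ (congrArg (_ ≫ ·) ((p.op.ranCounit.app Y).naturality
          (WithTerminal.homFrom zz).op))
        refine (Category.assoc _ _ _).symm.trans (Eq.trans ?_ (Category.assoc _ _ _))
        refine congrArg (· ≫ _) ?_
        refine (((genS C).obj Y).map_comp _ _).symm.trans
          (Eq.trans ?_ (((genS C).obj Y).map_comp _ _))
        exact congrArg (fun t => ((genS C).obj Y).map (Quiver.Hom.op t)) e))
    (by
      refine Eq.trans ?_ (congrArg (_ ≫ ·) (Preaug.mk_aug _ _ _)).symm
      refine Eq.trans ?_ (pullback.lift_fst _ _ _).symm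
      refine (Category.assoc _ _ _).symm.trans (congrArg (· ≫ _) ?_)
      exact (((genS C).obj Y).map_comp _ _).symm)

/-- The comparison `P (S Y) ⟶ S (P Y)`. -/
noncomputable def pathComparison (Y : Preaug C) :
    (path C).obj ((genS C).obj Y) ⟶ (genS C).obj Y.path :=
  (p.op.ranAdjunction C).homEquiv _ _ (pathComparisonAdj Y)

end Preaug

/-! ## Exact nerves and the `S_•`-construction of an exact category -/

/-- The full subgroupoid, spanned by the objects which satisfy `P`, of the maximal subgroupoid
of a category: its morphisms are the isomorphisms. -/
structure IsoFull {C : Type u} [Category.{v} C] (P : ObjectProperty C) : Type u where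
  obj : C
  property : P obj

namespace IsoFull

variable {C : Type u} [Category.{v} C] {P : ObjectProperty C}

instance groupoid : Groupoid.{v} (IsoFull P) where
  Hom X Y := X.obj ≅ Y.obj
  id X := Iso.refl X.obj
  comp a b := a ≪≫ b
  id_comp := Iso.refl_trans
  comp_id := Iso.trans_refl
  assoc := Iso.trans_assoc
  inv a := a.symm
  inv_comp := Iso.symm_self_id
  comp_inv := Iso.self_symm_id

universe v' u'

variable {D : Type u'} [Category.{v'} D] {Q : ObjectProperty D}

/-- The functor between full subgroupoids induced by a functor. -/
def map (T : C ⥤ D) (h : ∀ X, P X → Q (T.obj X)) : IsoFull P ⥤ IsoFull Q where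
  obj X := ⟨T.obj X.obj, h _ X.property⟩
  map {X Y} a := (T.mapIso a : T.obj X.obj ≅ T.obj Y.obj)
  map_id X := T.mapIso_refl X.obj
  map_comp a b := T.mapIso_trans a b

theorem map_congr {T T' : C ⥤ D} (e : T = T') (h : ∀ X, P X → Q (T.obj X))
    (h' : ∀ X, P X → Q (T'.obj X)) : map T h = map T' h' := by
  subst e; rfl

end IsoFull

section Nerve

variable {A : Type u} [Category.{v} A] [Preadditive A] [HasFiniteBiproducts A] [ExactCategory A]
variable {B : Type u} [Category.{v} B] [Preadditive B] [HasFiniteBiproducts B] [ExactCategory B]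

/-- A diagram `F`, indexed by a category `D` whose objects have a row and a column index, in which
all horizontal morphisms (those along a row) are admissible monomorphisms, all vertical morphisms
(those along a column) are admissible epimorphisms, and all squares formed by two horizontal and
two vertical morphisms are bicartesian. -/
structure IsAdmissible {D : Type} [SmallCategory D] {R C : Type} (row : D → R) (col : D → C)
    (F : D ⥤ A) : Prop where
  horizontal : ∀ {x y : D} (a : x ⟶ y), row x = row y → M A (F.map a)
  vertical : ∀ {x y : D} (a : x ⟶ y), col x = col y → E A (F.map a)
  square : ∀ {x y z w : D} (a : x ⟶ y) (b : x ⟶ z) (c : y ⟶ w) (d : z ⟶ w), a ≫ c = b ≫ d →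
    row x = row y → row z = row w → col x = col z → col y = col w →
    Bicartesian (F.map a) (F.map b) (F.map c) (F.map d)

theorem IsAdmissible.comp {D D' : Type} [SmallCategory D] [SmallCategory D'] {R C R' C' : Type}
    {row : D → R} {col : D → C} {row' : D' → R'} {col' : D' → C'} {F : D ⥤ A}
    (hF : IsAdmissible row col F) (G : D' ⥤ D)
    (hr : ∀ x y, row' x = row' y → row (G.obj x) = row (G.obj y))
    (hc : ∀ x y, col' x = col' y → col (G.obj x) = col (G.obj y)) :
    IsAdmissible row' col' (G ⋙ F) where
  horizontal a h := hF.horizontal (G.map a) (hr _ _ h)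
  vertical a h := hF.vertical (G.map a) (hc _ _ h)
  square a b c d sq h₁ h₂ h₃ h₄ := hF.square (G.map a) (G.map b) (G.map c) (G.map d)
    (by rw [← G.map_comp, sq, G.map_comp]) (hr _ _ h₁) (hr _ _ h₂) (hc _ _ h₃) (hc _ _ h₄)

theorem IsAdmissible.map {D : Type} [SmallCategory D] {R C : Type} {row : D → R} {col : D → C}
    {F : D ⥤ A} (hF : IsAdmissible row col F) (f : A ⥤ B) [f.Additive] [IsExactFunctor f] :
    IsAdmissible row col (F ⋙ f) where
  horizontal a h := M_map f _ (hF.horizontal a h)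
  vertical a h := E_map f _ (hF.vertical a h)
  square a b c d sq h₁ h₂ h₃ h₄ := (hF.square a b c d sq h₁ h₂ h₃ h₄).map f
    (hF.horizontal a h₁) (hF.vertical b h₃) (hF.vertical c h₄) (hF.horizontal d h₂)

/-- The category `[n]`. -/
abbrev Ord (n : SimplexCategory) : Type := Fin (n.len + 1)

abbrev ordMap {m n : SimplexCategory} (g : m ⟶ n) : Ord m ⥤ Ord n :=
  g.toOrderHom.monotone.functor

/-- The category `[k] × [l]`. -/
abbrev Grid (x : DeltaSq) : Type := Ord x.1 × Ord x.2

abbrev gridMap {x y : DeltaSq} (g : x ⟶ y) : Grid x ⥤ Grid y :=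
  (ordMap g.1).prod (ordMap g.2)

/-- The category `Ar[n]` of arrows of `[n]`, with objects the pairs `i ≤ j`. -/
abbrev Ar (n : SimplexCategory) : Type := Arrow (Ord n)

abbrev arMap {m n : SimplexCategory} (g : m ⟶ n) : Ar m ⥤ Ar n := (ordMap g).mapArrow

variable (A)

/-- The grids which are objects of the exact nerve in degree `x = (k, l)`: the first coordinate
is the row index and the second one is the column index. -/
def gridProp (x : DeltaSq) : ObjectProperty (Grid x ⥤ A) :=
  fun F => IsAdmissible Prod.fst Prod.snd F

/-- The bisimplicial groupoid underlying the exact nerve. -/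
def nerveBisimplicial : DeltaSqᵒᵖ ⥤ Grpd.{v, max v u} where
  obj x := Grpd.of (IsoFull (gridProp A x.unop))
  map {x y} g := (IsoFull.map ((Functor.whiskeringLeft _ _ A).obj (gridMap g.unop))
    (fun _ hF => hF.comp _ (fun _ _ h => congrArg g.unop.1.toOrderHom h)
      (fun _ _ h => congrArg g.unop.2.toOrderHom h)) :
      IsoFull (gridProp A x.unop) ⥤ IsoFull (gridProp A y.unop))
  map_id _ := rfl
  map_comp _ _ := rfl

/-- Zero objects of `A`, as diagrams of shape `[0] × [0]`. -/
def zeroProp : ObjectProperty (Grid zz ⥤ A) := fun F => ∀ x, IsZero (F.obj x)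

variable {A} in
theorem gridProp_of_zero {F : Grid zz ⥤ A} (h : zeroProp A F) : gridProp A zz F := by
  have hi {x y : Grid zz} (a : x ⟶ y) : IsIso (F.map a) := by
    rw [(h x).eq_of_src (F.map a) ((h x).iso (h y)).hom]
    infer_instance
  have w {x y z : Grid zz} (a : F.obj x ⟶ F.obj y) (b : F.obj y ⟶ F.obj z) : a ≫ b = 0 :=
    (h x).eq_of_src _ _
  have := @hi
  refine ⟨fun {x y} a _ => ⟨F.obj y, 0, w _ _, seq_of_isZero _ (h _) (h _) (h _)⟩,
    fun {x y} a _ => ⟨F.obj x, 0, w _ _, seq_of_isZero _ (h _) (h _) (h _)⟩,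
    fun a b c d sq _ _ _ _ => ?_⟩
  have sq' : CommSq (F.map a) (F.map b) (F.map c) (F.map d) :=
    ⟨by rw [← F.map_comp, sq, F.map_comp]⟩
  exact ⟨IsPullback.of_horiz_isIso sq', IsPushout.of_horiz_isIso sq'⟩

/-- The exact nerve. Its augmentation is the groupoid of zero objects of `A`, regarded, like
`(N^e A)_{0,0} = A_iso`, as a groupoid of diagrams of shape `[0] × [0]`. -/
def exactNerve : Preaug Grpd.{v, max v u} :=
  Preaug.mk (nerveBisimplicial A) (Grpd.of (IsoFull (zeroProp A)))
    (IsoFull.map (𝟭 _) (fun _ h => gridProp_of_zero h) :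
      IsoFull (zeroProp A) ⥤ IsoFull (gridProp A zz))

/-- The diagrams of shape `Ar[n]` with admissible monomorphisms along the rows, admissible
epimorphisms along the columns, bicartesian squares and zero objects on the diagonal. -/
def arProp (n : SimplexCategory) : ObjectProperty (Ar n ⥤ A) :=
  fun F => IsAdmissible (fun x => x.left) (fun x => x.right) F ∧
    ∀ x : Ar n, x.left = x.right → IsZero (F.obj x)

/-- The `S_•`-construction `S_•^e(A)` of an exact category, with arbitrary zero objects on the
diagonal. -/
def exactS : SimplexCategoryᵒᵖ ⥤ Grpd.{v, max v u} where
  obj n := Grpd.of (IsoFull (arProp A n.unop))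
  map {m n} g := (IsoFull.map ((Functor.whiskeringLeft _ _ A).obj (arMap g.unop))
    (fun _ hF => ⟨hF.1.comp _ (fun _ _ h => congrArg g.unop.toOrderHom h)
      (fun _ _ h => congrArg g.unop.toOrderHom h),
      fun _ h => hF.2 _ (congrArg g.unop.toOrderHom h)⟩) :
      IsoFull (arProp A m.unop) ⥤ IsoFull (arProp A n.unop))
  map_id _ := rfl
  map_comp _ _ := rfl

variable {A}

section

variable (f : A ⥤ B) [f.Additive] [IsExactFunctor f]

/-- The map `N^e f`. -/
def exactNerveMap : exactNerve A ⟶ exactNerve B :=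
  Preaug.homMk
    { app := fun x => (IsoFull.map ((Functor.whiskeringRight _ _ _).obj f) (fun _ h => h.map f) :
        IsoFull (gridProp A x.unop) ⥤ IsoFull (gridProp B x.unop))
      naturality := fun _ _ _ => rfl }
    (IsoFull.map ((Functor.whiskeringRight _ _ _).obj f) (fun _ h x => f.map_isZero (h x)) :
        IsoFull (zeroProp A) ⥤ IsoFull (zeroProp B))
    rfl

/-- The map `S_•^e(f)`. -/
def exactSMap : exactS A ⟶ exactS B where
  app n := (IsoFull.map ((Functor.whiskeringRight _ _ _).obj f)
      (fun _ h => ⟨h.1.map f, fun x hx => f.map_isZero (h.2 x hx)⟩) :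
      IsoFull (arProp A n.unop) ⥤ IsoFull (arProp B n.unop))
  naturality := fun _ _ _ => rfl

/-- The relative `S_•`-construction `S_•^rel(f)`, a pullback of simplicial groupoids. -/
noncomputable abbrev relS : SimplexCategoryᵒᵖ ⥤ Grpd.{v, max v u} :=
  pullback (pathD₀ (exactS B)) (exactSMap f)

/-- The relative exact nerve `N^rel f`, a pullback of preaugmented bisimplicial groupoids. -/
noncomputable abbrev relNerve : Preaug Grpd.{v, max v u} :=
  pullback (exactNerve B).pathD₀ (exactNerveMap f)

end

/-- The functor `[k] × [l] ⥤ Ar[k + 1 + l]`, which sends `(a, b)` to `a ≤ k + 1 + b`. -/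
def gridToAr (x : DeltaSq) : Grid x ⥤ Ar (join.obj x) where
  obj y := Arrow.mk (homOfLE (show (⟨y.1.val, by omega⟩ : Fin (x.1.len + x.2.len + 1 + 1)) ≤
    ⟨x.1.len + 1 + y.2.val, by omega⟩ from Fin.mk_le_mk.2 (by omega)))
  map {y z} g := Arrow.homMk
    (homOfLE (Fin.mk_le_mk.2 (by have : y.1.val ≤ z.1.val := leOfHom g.1; omega)))
    (homOfLE (Fin.mk_le_mk.2 (by have : y.2.val ≤ z.2.val := leOfHom g.2; omega)))
    (Subsingleton.elim _ _)

theorem ar_ext {n : SimplexCategory} {x y : Ar n} (hl : x.left = y.left)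
    (hr : x.right = y.right) : x = y := by
  obtain ⟨a, b, c⟩ := x
  obtain ⟨a', b', c'⟩ := y
  obtain rfl : a = a' := hl
  obtain rfl : b = b' := hr
  obtain rfl : c = c' := Subsingleton.elim (α := (a : Ord n) ⟶ b) c c'
  rfl

theorem ar_hom_ext {n : SimplexCategory} {x y : Ar n} (a b : x ⟶ y) : a = b :=
  Arrow.hom_ext _ _ (Subsingleton.elim _ _) (Subsingleton.elim _ _)

/-- The functor `[0] × [0] ⥤ Ar[0]`. -/
def zzToAr : Grid zz ⥤ Ar ⦋0⦌ := gridToAr zz ⋙ arMap (p.map (WithTerminal.homFrom zz))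

theorem gridToAr_naturality {x y : DeltaSq} (g : x ⟶ y) :
    gridToAr x ⋙ arMap (join.map g) = gridMap g ⋙ gridToAr y :=
  CategoryTheory.Functor.ext
    (fun z => ar_ext (Fin.ext (joinHom_left g.1 g.2 _ z.1 rfl))
      (Fin.ext (joinHom_right g.1 g.2 _ z.2 rfl)))
    (fun _ _ _ => ar_hom_ext _ _)

variable (A)

/-- Restriction of diagrams of shape `Ar[k + 1 + l]` to `[k] × [l]`. -/
def arToGrid (x : DeltaSq) : IsoFull (arProp A (join.obj x)) ⥤ IsoFull (gridProp A x) :=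
  IsoFull.map ((Functor.whiskeringLeft _ _ A).obj (gridToAr x))
    (fun _ hF => hF.1.comp _
      (fun _ _ h => Fin.ext (congrArg (fun t : Ord x.1 => t.val) h))
      (fun _ _ h => Fin.ext (congrArg (fun t : Ord x.2 => x.1.len + 1 + t.val) h)))

/-- The value of a diagram of shape `Ar[0]`. -/
def arToZero : IsoFull (arProp A ⦋0⦌) ⥤ IsoFull (zeroProp A) :=
  IsoFull.map ((Functor.whiskeringLeft _ _ A).obj zzToAr)
    (fun _ hF _ => hF.2 _ (Subsingleton.elim (α := Fin 1) _ _))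

/-- The map `p^* S_•^e(A) ⟶ N^e A` which is adjoint to the comparison map. -/
def comparisonAdj : p.op ⋙ exactS A ⟶ exactNerve A :=
  Preaug.homMk
    { app := fun x => arToGrid A x.unop
      naturality := fun x y g => IsoFull.map_congr (P := arProp A (join.obj x.unop))
        (Q := gridProp A y.unop) (congrArg (fun G => (Functor.whiskeringLeft _ _ A).obj G)
          (gridToAr_naturality g.unop))
        (fun X hX => (((exactS A).map (join.map g.unop).op ⋙ arToGrid A y.unop).obj
          ⟨X, hX⟩).property)
        (fun X hX => ((arToGrid A x.unop ⋙ (nerveBisimplicial A).map g).obj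
          ⟨X, hX⟩).property) }
    (arToZero A)
    rfl

/-- The comparison map `S_•^e(A) ⟶ S_•(N^e A)`. -/
noncomputable def comparison : exactS A ⟶ (genS _).obj (exactNerve A) :=
  (p.op.ranAdjunction _).homEquiv _ _ (comparisonAdj A)

end Nerve

end Sdot

/-!
A map `[q + 1 + r] ⟶ [m]` is the same thing as a rectangle in the staircase `Ar[m]`, and `Ar[m]` is
covered by the maximal rectangles, one for each cut point of `[m]`. A compatible family of grids, in
other words an object of `S_m(N^e A)`, therefore glues to a unique diagram of shape `Ar[m]`, and the
augmentation says that its diagonal vanishes: the comparison map is an isomorphism.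

The grids of `P N^e B` have one more row, so that the objects of `S_m(P N^e B)` are diagrams whose
shape is the staircase `Ar[1 + m]` without its corner `0 ≤ 0`. To extend such a diagram to
`Ar[1 + m]` is to choose a zero object at this corner, which is unique only up to unique
isomorphism. Hence `P S^e(B) ⟶ S(P N^e B)` is an equivalence in each degree which is surjective, but
not injective, on objects.

The right adjoint `S_•` preserves the pullback which defines `N^rel f`, so that the relative
comparison map is a base change of this surjective equivalence.
-/

namespace Sdot

/-! ## Surjective equivalences -/

section SurjectiveEquivalence

universe v₁ u₁ v₂ u₂ v₃ u₃

/-- An equivalence of categories which is surjective, and not merely essentially surjective, on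
objects. Between groupoids these are the acyclic fibrations. -/
structure IsSurjectiveEquivalence {C : Type u₁} [Category.{v₁} C] {D : Type u₂} [Category.{v₂} D]
    (G : C ⥤ D) : Prop where
  full : G.Full
  faithful : G.Faithful
  surjective : Function.Surjective G.obj

namespace IsSurjectiveEquivalence

section Categories

variable {C : Type u₁} [Category.{v₁} C] {D : Type u₂} [Category.{v₂} D]
  {E : Type u₃} [Category.{v₃} E]

theorem isEquivalence {G : C ⥤ D} (h : IsSurjectiveEquivalence G) : G.IsEquivalence where
  full := h.full
  faithful := h.faithful
  essSurj := ⟨fun d => (h.surjective d).imp fun _ hc => ⟨eqToIso hc⟩⟩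

theorem comp {G : C ⥤ D} {H : D ⥤ E} (hG : IsSurjectiveEquivalence G)
    (hH : IsSurjectiveEquivalence H) : IsSurjectiveEquivalence (G ⋙ H) where
  full := have := hG.full; have := hH.full; inferInstance
  faithful := have := hG.faithful; have := hH.faithful; inferInstance
  surjective := hH.surjective.comp hG.surjective

end Categories

variable {X Y Z : Grpd.{v, u}}

theorem isIsofibration {G : X ⟶ Y} (h : IsSurjectiveEquivalence G) : IsIsofibration G := by
  intro x y e
  obtain ⟨x', rfl⟩ := h.surjective y
  obtain ⟨a, rfl⟩ := h.full.map_surjective e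
  exact ⟨x', a, rfl, by simp⟩

theorem of_isIso (G : X ⟶ Y) [IsIso G] : IsSurjectiveEquivalence G := by
  have h₁ : 𝟭 X = G ⋙ inv G := (IsIso.hom_inv_id G).symm
  have h₂ : (inv G : Y ⥤ X) ⋙ G = 𝟭 Y := IsIso.inv_hom_id G
  have : Functor.IsEquivalence G :=
    (CategoryTheory.Equivalence.mk G (inv G) (eqToIso h₁) (eqToIso h₂)).isEquivalence_functor
  exact ⟨inferInstance, inferInstance, fun y => ⟨(inv G).obj y, Functor.congr_obj h₂ y⟩⟩

theorem isIso {G : X ⟶ Y} (h : IsSurjectiveEquivalence G) (hG : Function.Injective G.obj) :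
    IsIso G := by
  have := h.full
  have := h.faithful
  choose s hs using h.surjective
  let S : Y ⥤ X :=
    { obj := s
      map := fun {y y'} b => G.preimage (eqToHom (hs y) ≫ b ≫ eqToHom (hs y').symm)
      map_id := fun y => G.map_injective (by simp)
      map_comp := fun b b' => G.map_injective (by simp) }
  refine ⟨S, ?_, ?_⟩
  · refine CategoryTheory.Functor.ext (F := G ⋙ S) (G := 𝟭 X) (fun x => hG (hs (G.obj x)))
      (fun x y a => G.map_injective ?_)
    simp [S, eqToHom_map]
  · exact CategoryTheory.Functor.ext (F := S ⋙ G) (G := 𝟭 Y) hs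
      (fun x y a => by simp [S])

theorem of_comp_isIso {G : X ⟶ Y} {H : Y ⟶ Z} [IsIso H] (h : IsSurjectiveEquivalence (G ≫ H)) :
    IsSurjectiveEquivalence G := by
  have h' : IsSurjectiveEquivalence ((G ≫ H) ≫ inv H) := h.comp (of_isIso (inv H))
  rwa [Category.assoc, IsIso.hom_inv_id, Category.comp_id] at h'

theorem of_isIso_comp {G : X ⟶ Y} {H : Y ⟶ Z} [IsIso G] (h : IsSurjectiveEquivalence (G ≫ H)) :
    IsSurjectiveEquivalence H := by
  have h' : IsSurjectiveEquivalence (inv G ≫ G ≫ H) := (of_isIso (inv G)).comp h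
  rwa [← Category.assoc, IsIso.inv_hom_id, Category.id_comp] at h'

end IsSurjectiveEquivalence

theorem obj_injective_of_isIso {X Y : Grpd.{v, u}} (G : X ⟶ Y) [IsIso G] :
    Function.Injective G.obj := by
  have h : G ⋙ inv G = 𝟭 X := IsIso.hom_inv_id G
  exact Function.LeftInverse.injective (g := (inv G).obj) (Functor.congr_obj h)

end SurjectiveEquivalence

/-! ## Pullbacks of groupoids -/

section Pullback

theorem isIso_limitLift {J : Type} [SmallCategory J] {F : J ⥤ Grpd.{v, u}} {c : Cone F}
    (hc : IsLimit c) : IsIso (show c.pt ⟶ Grpd.of (GrpdLimit F) from GrpdLimit.lift F c) :=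
  (hc.conePointUniqueUpToIso (GrpdLimit.isLimit F)).isIso_hom

variable {P X W Z : Grpd.{v, u}} {s : P ⟶ X} {t : P ⟶ W} {g : X ⟶ Z} {h : W ⟶ Z}

/-- The functor from a pullback of groupoids to the explicit limit of its cospan. -/
def pullbackToLimit (pb : IsPullback s t g h) : P ⟶ Grpd.of (GrpdLimit (cospan g h)) :=
  GrpdLimit.lift _ pb.cone

instance isIso_pullbackToLimit (pb : IsPullback s t g h) : IsIso (pullbackToLimit pb) :=
  isIso_limitLift pb.isLimit

theorem exists_obj_of_isPullback (pb : IsPullback s t g h) (x : X) (w : W)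
    (e : g.obj x = h.obj w) : ∃ p : P, s.obj p = x ∧ t.obj p = w := by
  let q : GrpdLimit (cospan g h) :=
    { obj := fun i => match i with
        | none => h.obj w
        | some WalkingPair.left => x
        | some WalkingPair.right => w
      compat := fun {i k} f => by
        match i, k, f with
        | _, _, WidePullbackShape.Hom.id none => rfl
        | _, _, WidePullbackShape.Hom.id (some WalkingPair.left) => rfl
        | _, _, WidePullbackShape.Hom.id (some WalkingPair.right) => rfl
        | _, _, WidePullbackShape.Hom.term WalkingPair.left => exact e
        | _, _, WidePullbackShape.Hom.term WalkingPair.right => rfl }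
  obtain ⟨p, hp⟩ := (IsSurjectiveEquivalence.of_isIso (pullbackToLimit pb)).surjective q
  exact ⟨p, congrArg (fun z : GrpdLimit (cospan g h) => z.obj WalkingCospan.left) hp,
    congrArg (fun z : GrpdLimit (cospan g h) => z.obj WalkingCospan.right) hp⟩

theorem obj_ext_of_isPullback (pb : IsPullback s t g h) {p q : P} (e₁ : s.obj p = s.obj q)
    (e₂ : t.obj p = t.obj q) : p = q :=
  obj_injective_of_isIso (pullbackToLimit pb) (GrpdLimit.obj_ext fun i =>
    match i with
    | none => congrArg g.obj e₁
    | some WalkingPair.left => e₁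
    | some WalkingPair.right => e₂)

theorem hom_ext_of_isPullback (pb : IsPullback s t g h) {p q : P} {a b : p ⟶ q}
    (e₁ : s.map a = s.map b) (e₂ : t.map a = t.map b) : a = b :=
  (IsSurjectiveEquivalence.of_isIso (pullbackToLimit pb)).faithful.map_injective
    (GrpdLimit.hom_ext fun i =>
      match i with
      | none => congrArg g.map e₁
      | some WalkingPair.left => e₁
      | some WalkingPair.right => e₂)

theorem exists_hom_of_isPullback (pb : IsPullback s t g h) {p q : P} (a : s.obj p ⟶ s.obj q)
    (b : t.obj p ⟶ t.obj q) (e : g.map a = eqToHom (Functor.congr_obj pb.w p) ≫ h.map b ≫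
      eqToHom (Functor.congr_obj pb.w q).symm) :
    ∃ c : p ⟶ q, s.map c = a ∧ t.map c = b := by
  have conj_id {C : Type u} [Category.{v} C] {x y : C} (f : x ⟶ y) : f = 𝟙 x ≫ f ≫ 𝟙 y := by simp
  let φ : GrpdLimit.Hom ((pullbackToLimit pb).obj p) ((pullbackToLimit pb).obj q) :=
    { app := fun i => match i with
        | none => g.map a
        | some WalkingPair.left => a
        | some WalkingPair.right => b
      compat := fun {i k} f => by
        match i, k, f with
        | _, _, WidePullbackShape.Hom.id none => exact conj_id (g.map a)
        | _, _, WidePullbackShape.Hom.id (some WalkingPair.left) => exact conj_id a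
        | _, _, WidePullbackShape.Hom.id (some WalkingPair.right) => exact conj_id b
        | _, _, WidePullbackShape.Hom.term WalkingPair.left => exact conj_id (g.map a)
        | _, _, WidePullbackShape.Hom.term WalkingPair.right =>
          exact GrpdLimit.eq_conj _ _ _ _ e _ _ }
  obtain ⟨c, hc⟩ :=
    (IsSurjectiveEquivalence.of_isIso (pullbackToLimit pb)).full.map_surjective (X := p) (Y := q) φ
  exact ⟨c, congrArg (GrpdLimit.Hom.app · WalkingCospan.left) hc,
    congrArg (GrpdLimit.Hom.app · WalkingCospan.right) hc⟩

theorem IsSurjectiveEquivalence.of_isPullback (pb : IsPullback s t g h)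
    (hg : IsSurjectiveEquivalence g) : IsSurjectiveEquivalence t where
  surjective w := by
    obtain ⟨x, hx⟩ := hg.surjective (h.obj w)
    obtain ⟨p, -, hp⟩ := exists_obj_of_isPullback pb x w hx
    exact ⟨p, hp⟩
  full := ⟨fun {p q} b => by
    obtain ⟨a, ha⟩ := hg.full.map_surjective (X := s.obj p) (Y := s.obj q)
      (eqToHom (Functor.congr_obj pb.w p) ≫ h.map b ≫ eqToHom (Functor.congr_obj pb.w q).symm)
    obtain ⟨c, -, hc⟩ := exists_hom_of_isPullback pb a b ha
    exact ⟨c, hc⟩⟩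
  faithful := ⟨fun {p q a b} e => by
    refine hom_ext_of_isPullback pb (hg.faithful.map_injective ?_) e
    have hab : (t ≫ h).map a = (t ≫ h).map b := congrArg h.map e
    exact (Functor.congr_hom pb.w a).trans
      (Eq.trans (by rw [hab]) (Functor.congr_hom pb.w b).symm)⟩

theorem obj_fst_injective_of_isPullback (pb : IsPullback s t g h)
    (hh : Function.Injective h.obj) : Function.Injective s.obj := fun p q e =>
  obj_ext_of_isPullback pb e (hh ((Functor.congr_obj pb.w p).symm.trans
    ((congrArg g.obj e).trans (Functor.congr_obj pb.w q))))

theorem faithful_fst_of_isPullback (pb : IsPullback s t g h) (hh : Functor.Faithful h) :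
    Functor.Faithful s where
  map_injective {p q a b} e := by
    refine hom_ext_of_isPullback pb e (hh.map_injective ?_)
    have hab := (Functor.congr_hom pb.w a).symm.trans
      ((congrArg g.map e).trans (Functor.congr_hom pb.w b))
    exact (cancel_mono _).1 ((cancel_epi _).1 hab)

end Pullback

/-! ## The generalized construction as an explicit limit -/

section GenS

variable {X : SimplexCategoryᵒᵖ ⥤ Grpd.{v, u}} {Y : Preaug Grpd.{v, u}}

/-- The diagram whose limit is the generalized construction of `Y` in degree `n`. -/
abbrev genDiagram (Y : Preaug Grpd.{v, u}) (n : SimplexCategoryᵒᵖ) :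
    StructuredArrow n p.op ⥤ Grpd.{v, u} :=
  StructuredArrow.proj n p.op ⋙ Y

/-- The functor from `X_n` to the explicit limit given by a map `p^* X ⟶ Y`. -/
def adjunctToLimit (β : p.op ⋙ X ⟶ Y) (n : SimplexCategoryᵒᵖ) :
    X.obj n ⟶ Grpd.of (GrpdLimit (genDiagram Y n)) :=
  GrpdLimit.lift _ ((Functor.RightExtension.mk X β).coneAt n)

theorem whiskerLeft_homEquiv_ranCounit (β : p.op ⋙ X ⟶ Y) :
    Functor.whiskerLeft p.op ((p.op.ranAdjunction _).homEquiv X Y β) ≫ p.op.ranCounit.app Y =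
      β := by
  have := ((p.op.ranAdjunction Grpd.{v, u}).homEquiv X Y).symm_apply_apply β
  rwa [Adjunction.homEquiv_counit, Functor.ranAdjunction_counit] at this

theorem exists_isIso_homEquiv_app_comp (β : p.op ⋙ X ⟶ Y) (n : SimplexCategoryᵒᵖ) :
    ∃ e : ((genS _).obj Y).obj n ⟶ Grpd.of (GrpdLimit (genDiagram Y n)), IsIso e ∧
      ((p.op.ranAdjunction _).homEquiv X Y β).app n ≫ e = adjunctToLimit β n := by
  refine ⟨_, isIso_limitLift (p.op.isPointwiseRightKanExtensionRanCounit Y n), ?_⟩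
  refine (GrpdLimit.isLimit (genDiagram Y n)).hom_ext fun k => ?_
  change ((p.op.ranAdjunction _).homEquiv X Y β).app n ≫ ((genS _).obj Y).map k.hom ≫
    (p.op.ranCounit.app Y).app k.right = X.map k.hom ≫ β.app k.right
  rw [← NatTrans.naturality_assoc]
  exact congrArg (X.map k.hom ≫ ·)
    (NatTrans.congr_app (whiskerLeft_homEquiv_ranCounit β) k.right)

theorem isSurjectiveEquivalence_homEquiv_app {β : p.op ⋙ X ⟶ Y} {n : SimplexCategoryᵒᵖ}
    (h : IsSurjectiveEquivalence (adjunctToLimit β n)) :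
    IsSurjectiveEquivalence (((p.op.ranAdjunction _).homEquiv X Y β).app n) := by
  obtain ⟨e, _, w⟩ := exists_isIso_homEquiv_app_comp β n
  exact IsSurjectiveEquivalence.of_comp_isIso (H := e) (by rwa [w])

theorem isIso_homEquiv_app {β : p.op ⋙ X ⟶ Y} {n : SimplexCategoryᵒᵖ}
    (h : IsIso (adjunctToLimit β n)) :
    IsIso (((p.op.ranAdjunction _).homEquiv X Y β).app n) := by
  obtain ⟨e, _, w⟩ := exists_isIso_homEquiv_app_comp β n
  have : IsIso (((p.op.ranAdjunction _).homEquiv X Y β).app n ≫ e) := by rwa [w]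
  exact IsIso.of_isIso_comp_right _ e

variable {m : SimplexCategory}

/-- The index of the limit defining `(S Y)_m` given by a map `[q + 1 + r] ⟶ [m]`. -/
abbrev gridIndex {y : DeltaSq} (β : join.obj y ⟶ m) : StructuredArrow (op m) p.op :=
  StructuredArrow.mk (Y := op (WithTerminal.of y)) (show op m ⟶ p.op.obj _ from β.op)

/-- The index of the limit defining `(S Y)_m` given by a vertex of `[m]`. -/
abbrev augIndex (i : (⦋0⦌ : SimplexCategory) ⟶ m) : StructuredArrow (op m) p.op :=
  StructuredArrow.mk (Y := op WithTerminal.star) (show op m ⟶ p.op.obj _ from i.op)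

/-- The morphism of indices over which a compatible family is restricted along `g`. -/
abbrev gridIndexHom {x y : DeltaSq} (g : x ⟶ y) (β : join.obj y ⟶ m) :
    gridIndex β ⟶ gridIndex (join.map g ≫ β) :=
  StructuredArrow.homMk (WithTerminal.incl.map g).op rfl

/-- The morphism of indices which relates a vertex of `[m]` to the constant map `[1] ⟶ [m]`,
through the augmentation of `Y`. -/
abbrev augIndexHom (i : (⦋0⦌ : SimplexCategory) ⟶ m) :
    augIndex i ⟶ gridIndex (y := zz) (p.map (WithTerminal.homFrom zz) ≫ i) :=
  StructuredArrow.homMk (WithTerminal.homFrom zz).op rfl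

theorem eq_gridIndex_or_eq_augIndex (k : StructuredArrow (op m) p.op) :
    (∃ (y : DeltaSq) (β : join.obj y ⟶ m), k = gridIndex β) ∨
      ∃ i : (⦋0⦌ : SimplexCategory) ⟶ m, k = augIndex i := by
  obtain ⟨⟨⟨⟩⟩, ⟨x⟩, f⟩ := k
  match x, f with
  | .of y, f => exact Or.inl ⟨y, f.unop, rfl⟩
  | .star, f => exact Or.inr ⟨f.unop, rfl⟩

theorem genLimit_obj_ext (hY : Function.Injective Y.aug.obj)
    {x x' : GrpdLimit (genDiagram Y (op m))}
    (h : ∀ {y : DeltaSq} (β : join.obj y ⟶ m), x.obj (gridIndex β) = x'.obj (gridIndex β)) :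
    x = x' := by
  refine GrpdLimit.obj_ext fun k => ?_
  obtain ⟨y, β, rfl⟩ | ⟨i, rfl⟩ := eq_gridIndex_or_eq_augIndex k
  · exact h β
  · exact hY ((x.compat (augIndexHom i)).trans ((h _).trans (x'.compat (augIndexHom i)).symm))

theorem genLimit_hom_ext (hY : Functor.Faithful Y.aug)
    {x x' : GrpdLimit (genDiagram Y (op m))} {s t : x ⟶ x'}
    (h : ∀ {y : DeltaSq} (β : join.obj y ⟶ m),
      GrpdLimit.Hom.app s (gridIndex β) = GrpdLimit.Hom.app t (gridIndex β)) : s = t := by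
  refine GrpdLimit.hom_ext fun k => ?_
  obtain ⟨y, β, rfl⟩ | ⟨i, rfl⟩ := eq_gridIndex_or_eq_augIndex k
  · exact h β
  · refine hY.map_injective ((GrpdLimit.Hom.compat s (augIndexHom i)).trans
      (Eq.trans ?_ (GrpdLimit.Hom.compat t (augIndexHom i)).symm))
    rw [h]

end GenS

/-! ## Gluing diagrams on staircases -/

section Gluing

variable {P J : Type} [Preorder P] [Preorder J]

/-- The preorder of pairs `(a, b)` with `a ≤ η b`. For `η` the identity of `[n]` this is `Ar[n]`. -/
abbrev Staircase (η : J ⥤ P) : Type := Comma (𝟭 P) η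

variable {η : J ⥤ P}

namespace Staircase

theorem ext {x y : Staircase η} (hl : x.left = y.left) (hr : x.right = y.right) : x = y := by
  obtain ⟨a, b, c⟩ := x
  obtain ⟨a', b', c'⟩ := y
  obtain rfl : a = a' := hl
  obtain rfl : b = b' := hr
  rw [Subsingleton.elim c c']

instance : Quiver.IsThin (Staircase η) := fun _ _ =>
  ⟨fun _ _ => CommaMorphism.ext (Subsingleton.elim _ _) (Subsingleton.elim _ _)⟩

/-- The pair `(a, b)` as an element of the staircase. -/
abbrev mk (a : P) (b : J) (h : a ≤ η.obj b) : Staircase η := ⟨a, b, homOfLE h⟩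

/-- The order relation of a staircase, which is the componentwise one, as a morphism. -/
abbrev homMk {x y : Staircase η} (hl : x.left ≤ y.left) (hr : x.right ≤ y.right) : x ⟶ y :=
  ⟨homOfLE hl, homOfLE hr, Subsingleton.elim _ _⟩

variable (η) in
/-- The inclusion of a staircase into the full rectangle `P × J`. -/
abbrev toRect : Staircase η ⥤ P × J := (Comma.fst (𝟭 P) η).prod' (Comma.snd (𝟭 P) η)

variable (η) in
/-- The part `{(a, b) | a ≤ η k, k ≤ b}` of a staircase: the largest rectangle in it whose corner
is `(η k, k)`. -/
def window (k : J) : ObjectProperty (Staircase η) := fun x => x.left ≤ η.obj k ∧ k ≤ x.right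

universe v₁ u₁

variable {C : Type u₁} [Category.{v₁} C]

theorem functor_ext {G G' : Staircase η ⥤ C}
    (h : ∀ k, (window η k).ι ⋙ G = (window η k).ι ⋙ G') : G = G' := by
  have h' {x y : Staircase η} (f : x ⟶ y) (hf : y.left ≤ η.obj x.right) :
      Arrow.mk (G.map f) = Arrow.mk (G'.map f) :=
    congrArg (fun H : (window η x.right).FullSubcategory ⥤ C => Arrow.mk (H.map
      (show (⟨x, leOfHom x.hom, le_rfl⟩ : (window η x.right).FullSubcategory) ⟶
        ⟨y, hf, leOfHom f.right⟩ from ObjectProperty.homMk f))) (h x.right)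
  refine Arrow.functor_ext fun x y f => ?_
  -- Every morphism is a horizontal one followed by a vertical one.
  let z : Staircase η := mk x.left y.right
    ((leOfHom x.hom).trans (leOfHom (η.map f.right)))
  let hor : x ⟶ z := homMk le_rfl (leOfHom f.right)
  let ver : z ⟶ y := homMk (leOfHom f.left) le_rfl
  obtain ⟨hx, hz, e₁⟩ := (Arrow.mk_eq_mk_iff _ _).1 (h' hor (leOfHom x.hom))
  obtain ⟨_, hy, e₂⟩ := (Arrow.mk_eq_mk_iff _ _).1 (h' ver (leOfHom y.hom))
  refine (Arrow.mk_eq_mk_iff _ _).2 ⟨hx, hy, ?_⟩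
  rw [Subsingleton.elim f (hor ≫ ver)]
  change G.map (hor ≫ ver) = eqToHom hx ≫ G'.map (hor ≫ ver) ≫ eqToHom hy.symm
  rw [G.map_comp, G'.map_comp, e₁, e₂]
  simp

end Staircase

universe v₁ u₁

/-- Diagrams on the rectangle `P × J`, one for each `k : J`, of which the `k`-th is relevant on the
window at `k` of the staircase, and which agree on the intersections of the windows. -/
structure StaircaseCocycle (η : J ⥤ P) (C : Type u₁) [Category.{v₁} C] where
  diagram : J → P × J ⥤ C
  agree : ∀ k l, (Staircase.window η k ⊓ Staircase.window η l).ι ⋙ Staircase.toRect η ⋙ diagram k =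
    (Staircase.window η k ⊓ Staircase.window η l).ι ⋙ Staircase.toRect η ⋙ diagram l

namespace StaircaseCocycle

variable {C : Type u₁} [Category.{v₁} C] (F : StaircaseCocycle η C)

theorem obj_eq {a : P} {b k l : J} (hk : a ≤ η.obj k) (hk' : k ≤ b) (hl : a ≤ η.obj l)
    (hl' : l ≤ b) : (F.diagram k).obj (a, b) = (F.diagram l).obj (a, b) :=
  Functor.congr_obj (F.agree k l) ⟨Staircase.mk a b (hk.trans (leOfHom (η.map (homOfLE hk')))),
    ⟨hk, hk'⟩, hl, hl'⟩

theorem map_eq {x y : P × J} (f : x ⟶ y) {k l : J} (hk : y.1 ≤ η.obj k) (hk' : k ≤ x.2)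
    (hl : y.1 ≤ η.obj l) (hl' : l ≤ x.2) :
    (F.diagram k).map f =
      eqToHom (F.obj_eq ((leOfHom f.1).trans hk) hk' ((leOfHom f.1).trans hl) hl') ≫
        (F.diagram l).map f ≫
          eqToHom (F.obj_eq hk (hk'.trans (leOfHom f.2)) hl (hl'.trans (leOfHom f.2))).symm :=
  have hx := (leOfHom f.1).trans (hk.trans (leOfHom (η.map (homOfLE hk'))))
  have hy := hk.trans (leOfHom (η.map (homOfLE (hk'.trans (leOfHom f.2)))))
  Functor.congr_hom (F.agree k l)
    (X := ⟨Staircase.mk x.1 x.2 hx, ⟨(leOfHom f.1).trans hk, hk'⟩, (leOfHom f.1).trans hl, hl'⟩)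
    (Y := ⟨Staircase.mk y.1 y.2 hy, ⟨hk, hk'.trans (leOfHom f.2)⟩, hl, hl'.trans (leOfHom f.2)⟩)
    (ObjectProperty.homMk (Staircase.homMk (leOfHom f.1) (leOfHom f.2)))

/-- The morphism of `P × J` along a row. -/
abbrev hor (a : P) {b b' : J} (g : b ⟶ b') : (a, b) ⟶ (a, b') := (𝟙 a, g)

/-- The morphism of `P × J` along a column. -/
abbrev ver {a a' : P} (f : a ⟶ a') (b : J) : (a, b) ⟶ (a', b) := (f, 𝟙 b)

/-- The value on `f : x ⟶ y` of the glued diagram: along the row of `x` in the diagram with index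
`x.right`, then along the column of `y` in the diagram with index `y.right`. -/
def glueMap {x y : Staircase η} (f : x ⟶ y) :
    (F.diagram x.right).obj (x.left, x.right) ⟶ (F.diagram y.right).obj (y.left, y.right) :=
  (F.diagram x.right).map (hor x.left f.right) ≫
    eqToHom (F.obj_eq (leOfHom x.hom) (leOfHom f.right)
      ((leOfHom x.hom).trans (leOfHom (η.map f.right))) le_rfl) ≫
    (F.diagram y.right).map (ver f.left y.right)

theorem glueMap_eq {x y : Staircase η} (f : x ⟶ y) {k : J} (hy : y.left ≤ η.obj k)
    (hx : k ≤ x.right) :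
    F.glueMap f = eqToHom (F.obj_eq (leOfHom x.hom) le_rfl ((leOfHom f.left).trans hy) hx) ≫
      (F.diagram k).map ((Staircase.toRect η).map f) ≫
        eqToHom (F.obj_eq hy (hx.trans (leOfHom f.right)) (leOfHom y.hom) le_rfl) := by
  have hf : (Staircase.toRect η).map f = hor x.left f.right ≫ ver f.left y.right := by
    simp [hor, ver, prod_comp]
  rw [glueMap, F.map_eq (hor x.left f.right) (leOfHom x.hom) le_rfl ((leOfHom f.left).trans hy) hx,
    F.map_eq (ver f.left y.right) (leOfHom y.hom) le_rfl hy (hx.trans (leOfHom f.right)), hf,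
    (F.diagram k).map_comp]
  simp only [Category.assoc, eqToHom_trans_assoc, eqToHom_refl, Category.id_comp]

/-- The diagram on the staircase glued from a cocycle. -/
def glue : Staircase η ⥤ C where
  obj x := (F.diagram x.right).obj (x.left, x.right)
  map f := F.glueMap f
  map_id x := by
    rw [F.glueMap_eq (𝟙 x) (leOfHom x.hom) le_rfl, (Staircase.toRect η).map_id]
    change _ ≫ (F.diagram x.right).map (𝟙 (x.left, x.right)) ≫ _ = _
    rw [(F.diagram x.right).map_id]
    simp only [Category.id_comp, eqToHom_refl]
    rfl
  map_comp {x y z} f g := by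
    have hx : x.left ≤ η.obj y.right := (leOfHom x.hom).trans (leOfHom (η.map f.right))
    have interchange : (F.diagram y.right).map (ver f.left y.right) ≫
        (F.diagram y.right).map (hor y.left g.right) =
        (F.diagram y.right).map (hor x.left g.right) ≫
          (F.diagram y.right).map (ver f.left z.right) := by
      simp only [← Functor.map_comp]
      congr 1
    have e₁ := F.map_eq (hor x.left g.right) hx le_rfl (leOfHom x.hom) (leOfHom f.right)
    have e₂ := F.map_eq (ver f.left z.right) (leOfHom y.hom) (leOfHom g.right)
      ((leOfHom y.hom).trans (leOfHom (η.map g.right))) le_rfl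
    have hc₁ : hor x.left (f ≫ g).right = hor x.left f.right ≫ hor x.left g.right := by
      simp [hor, prod_comp]
    have hc₂ : ver (f ≫ g).left z.right = ver f.left z.right ≫ ver g.left z.right := by
      simp [ver, prod_comp]
    simp only [glueMap, Category.assoc, reassoc_of% interchange, e₁, e₂, hc₁, hc₂,
      Functor.map_comp]
    simp

theorem window_ι_comp_glue (k : J) :
    (Staircase.window η k).ι ⋙ F.glue =
      (Staircase.window η k).ι ⋙ Staircase.toRect η ⋙ F.diagram k :=
  CategoryTheory.Functor.ext
    (fun x => F.obj_eq (leOfHom x.obj.hom) le_rfl x.property.1 x.property.2)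
    (fun x y f => F.glueMap_eq f.hom y.property.1 x.property.2)

end StaircaseCocycle

end Gluing

/-! ## Cutting an ordinal at a vertex -/

section Cut

variable {x y : DeltaSq} {m : SimplexCategory}

/-- The inclusion of the first summand of the ordinal sum. -/
def joinInl (y : DeltaSq) : y.1 ⟶ join.obj y :=
  SimplexCategory.mkHom (n := y.1.len)
    { toFun := fun a => ⟨a.val, by omega⟩
      monotone' := fun _ _ h => h }

/-- The inclusion of the second summand of the ordinal sum. -/
def joinInr (y : DeltaSq) : y.2 ⟶ join.obj y :=
  SimplexCategory.mkHom (n := y.2.len)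
    { toFun := fun b => ⟨y.1.len + 1 + b.val, by omega⟩
      monotone' := fun _ _ h => Nat.add_le_add_left h _ }

theorem joinInl_le_joinInr (a : Ord y.1) (b : Ord y.2) :
    (joinInl y).toOrderHom a ≤ (joinInr y).toOrderHom b :=
  Fin.mk_le_mk.2 (by omega)

theorem joinInl_map (g : x ⟶ y) : joinInl x ≫ join.map g = g.1 ≫ joinInl y :=
  hom_ext_val fun a => joinHom_left g.1 g.2 _ a rfl

theorem joinInr_map (g : x ⟶ y) : joinInr x ≫ join.map g = g.2 ≫ joinInr y :=
  hom_ext_val fun b => joinHom_right g.1 g.2 _ b rfl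

theorem join_hom_ext {f g : join.obj y ⟶ m} (hl : joinInl y ≫ f = joinInl y ≫ g)
    (hr : joinInr y ≫ f = joinInr y ≫ g) : f = g :=
  hom_ext_val fun i => by
    obtain ⟨a, ha⟩ | ⟨b, hb⟩ := join_cases y.1.len y.2.len i
    · obtain rfl : i = (joinInl y).toOrderHom a := Fin.ext ha
      exact congrArg (fun h : y.1 ⟶ m => (h.toOrderHom a).val) hl
    · obtain rfl : i = (joinInr y).toOrderHom b := Fin.ext hb
      exact congrArg (fun h : y.2 ⟶ m => (h.toOrderHom b).val) hr

/-- The map `min(-, k)`, which retracts `[m]` onto the vertices up to `k`. -/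
def minHom (k : Ord m) : m ⟶ m := SimplexCategory.mkHom
  { toFun := fun a => min a k
    monotone' := fun _ _ h => min_le_min_right k h }

/-- The map `max(-, k)`, which retracts `[m]` onto the vertices from `k` on. -/
def maxHom (k : Ord m) : m ⟶ m := SimplexCategory.mkHom
  { toFun := fun b => max b k
    monotone' := fun _ _ h => max_le_max_right k h }

/-- The map `[m] ⋆ [m] ⟶ [m]` which is `min(-, k)` on the first summand and `max(-, k)` on the
second one. -/
def cut (k : Ord m) : join.obj (m, m) ⟶ m := SimplexCategory.mkHom (n := m.len + m.len + 1)
  { toFun := fun i =>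
      if h : i.val ≤ m.len then min ⟨i.val, by omega⟩ k else max ⟨i.val - (m.len + 1), by omega⟩ k
    monotone' := fun i i' h => by
      have h' : i.val ≤ i'.val := h
      dsimp only
      split_ifs with h₁ h₂ h₂
      · exact min_le_min_right k (Fin.mk_le_mk.2 h')
      · exact (min_le_right _ _).trans (le_max_right _ _)
      · omega
      · exact max_le_max_right k (Fin.mk_le_mk.2 (by omega)) }

theorem joinInl_cut (k : Ord m) : joinInl (m, m) ≫ cut k = minHom k :=
  hom_ext_val fun a => congrArg Fin.val (dif_pos (Nat.lt_succ_iff.1 a.isLt))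

theorem joinInr_cut (k : Ord m) : joinInr (m, m) ≫ cut k = maxHom k :=
  hom_ext_val fun b => congrArg Fin.val <| by
    have hb : ¬m.len + 1 + b.val ≤ m.len := by omega
    exact (dif_neg hb).trans (congrArg (max · k) (Fin.ext (Nat.add_sub_cancel_left _ _)))

/-- The two components of a map out of an ordinal sum. -/
abbrev joinComponents (β : join.obj y ⟶ m) : y ⟶ (m, m) := (joinInl y ≫ β, joinInr y ≫ β)

/-- The vertex at which the second component of a map out of an ordinal sum starts. -/
abbrev cutPoint (β : join.obj y ⟶ m) : Ord m := (joinInr y ≫ β).toOrderHom 0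

theorem joinComponents_fst_le (β : join.obj y ⟶ m) (a : Ord y.1) :
    (joinInl y ≫ β).toOrderHom a ≤ cutPoint β :=
  β.toOrderHom.monotone (joinInl_le_joinInr a 0)

theorem le_joinComponents_snd (β : join.obj y ⟶ m) (b : Ord y.2) :
    cutPoint β ≤ (joinInr y ≫ β).toOrderHom b :=
  (joinInr y ≫ β).toOrderHom.monotone (Fin.zero_le b)

theorem join_map_comp_cut {y : DeltaSq} (g : y ⟶ (m, m)) {k : Ord m}
    (hl : ∀ a, g.1.toOrderHom a ≤ k) (hr : ∀ b, k ≤ g.2.toOrderHom b) :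
    joinInl y ≫ join.map g ≫ cut k = g.1 ∧ joinInr y ≫ join.map g ≫ cut k = g.2 := by
  rw [← Category.assoc, joinInl_map, Category.assoc, joinInl_cut, ← Category.assoc, joinInr_map,
    Category.assoc, joinInr_cut]
  exact ⟨hom_ext_val fun a => congrArg Fin.val (min_eq_left (hl a)),
    hom_ext_val fun b => congrArg Fin.val (max_eq_left (hr b))⟩

theorem joinComponents_map_comp_cut (β : join.obj y ⟶ m) :
    join.map (joinComponents β) ≫ cut (cutPoint β) = β :=
  have h := join_map_comp_cut (joinComponents β) (joinComponents_fst_le β) (le_joinComponents_snd β)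
  join_hom_ext h.1 h.2

theorem join_map_comp_cut_congr (g : y ⟶ (m, m)) {k l : Ord m}
    (hk : ∀ a, g.1.toOrderHom a ≤ k) (hk' : ∀ b, k ≤ g.2.toOrderHom b)
    (hl : ∀ a, g.1.toOrderHom a ≤ l) (hl' : ∀ b, l ≤ g.2.toOrderHom b) :
    join.map g ≫ cut k = join.map g ≫ cut l := by
  obtain ⟨h₁, h₂⟩ := join_map_comp_cut g hk hk'
  obtain ⟨h₃, h₄⟩ := join_map_comp_cut g hl hl'
  exact join_hom_ext (h₁.trans h₃.symm) (h₂.trans h₄.symm)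

end Cut

/-! ## Row extensions -/

/-- A natural way of adding at most one vertex, below all other ones, to the ordinals `[n]`. The
two examples are the identity, and `[n] ↦ [0] ⋆ [n]`, which give the rows of the exact nerve and
of its initial path construction. -/
structure RowExtension where
  functor : SimplexCategory ⥤ SimplexCategory
  unit : 𝟭 SimplexCategory ⟶ functor
  injective : ∀ m, Function.Injective (unit.app m).toOrderHom
  mem_range_of_le : ∀ {m : SimplexCategory} {b : Ord m} {a : Ord (functor.obj m)},
    (unit.app m).toOrderHom b ≤ a → a ∈ Set.range (unit.app m).toOrderHom
  eq_of_notMem_range : ∀ {m : SimplexCategory} {a a' : Ord (functor.obj m)},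
    a ∉ Set.range (unit.app m).toOrderHom → a' ∉ Set.range (unit.app m).toOrderHom → a = a'
  map_notMem_range : ∀ {m n : SimplexCategory} (f : m ⟶ n) {a : Ord (functor.obj m)},
    a ∉ Set.range (unit.app m).toOrderHom →
      (functor.map f).toOrderHom a ∉ Set.range (unit.app n).toOrderHom

namespace RowExtension

/-- The row extension which adds no vertex. -/
def identity : RowExtension where
  functor := 𝟭 _
  unit := 𝟙 _
  injective _ := Function.injective_id
  mem_range_of_le {_ _ a} _ := ⟨a, rfl⟩
  eq_of_notMem_range {_ a _} h := (h ⟨a, rfl⟩).elim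
  map_notMem_range {_ _} _ {a} h := (h ⟨a, rfl⟩).elim

theorem mem_range_inclJ {m : SimplexCategory} {a : Ord (j.obj m)} :
    a ∈ Set.range (inclJ m).toOrderHom ↔ a.val ≠ 0 := by
  constructor
  · rintro ⟨b, rfl⟩
    exact Nat.succ_ne_zero b.val
  · intro h
    have hlt : a.val < 0 + m.len + 1 + 1 := a.isLt
    have hb : a.val - 1 < m.len + 1 := by omega
    exact ⟨(⟨a.val - 1, hb⟩ : Fin (m.len + 1)), Fin.ext (show a.val - 1 + 1 = a.val by omega)⟩

theorem notMem_range_inclJ {m : SimplexCategory} {a : Ord (j.obj m)} :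
    a ∉ Set.range (inclJ m).toOrderHom ↔ a.val = 0 :=
  mem_range_inclJ.not.trans not_not

/-- The row extension which adds an initial vertex. -/
def cone : RowExtension where
  functor := j
  unit := toJ
  injective _ _ _ h := Fin.ext (Nat.succ_injective (congrArg Fin.val h))
  mem_range_of_le {_ b _} h := mem_range_inclJ.2 ((Nat.succ_pos b.val).trans_le h).ne'
  eq_of_notMem_range h h' :=
    Fin.ext ((notMem_range_inclJ.1 h).trans (notMem_range_inclJ.1 h').symm)
  map_notMem_range g a h := notMem_range_inclJ.2
    (joinHom_left (𝟙 (⦋0⦌ : SimplexCategory)) g a 0 (notMem_range_inclJ.1 h))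

variable (R : RowExtension) {m n : SimplexCategory}

/-- The row extension, applied to the row index of a grid. -/
abbrev shift : DeltaSq ⥤ DeltaSq where
  obj x := (R.functor.obj x.1, x.2)
  map g := (R.functor.map g.1, g.2)

/-- The inclusion of the columns `[m]` into the rows. -/
abbrev incl (m : SimplexCategory) : Ord m ⥤ Ord (R.functor.obj m) := ordMap (R.unit.app m)

theorem map_incl (f : m ⟶ n) (b : Ord m) :
    (R.functor.map f).toOrderHom ((R.incl m).obj b) = (R.incl n).obj (f.toOrderHom b) :=
  congrArg (fun g : m ⟶ R.functor.obj n => g.toOrderHom b) (R.unit.naturality f).symm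

variable {R}

theorem le_of_incl_le {b c : Ord m} (h : (R.incl m).obj b ≤ (R.incl m).obj c) : b ≤ c :=
  ((R.unit.app m).toOrderHom.monotone.strictMono_of_injective (R.injective m)).le_iff_le.1 h

theorem eq_of_le_of_notMem_range {a c : Ord (R.functor.obj m)} (h : a ≤ c)
    (hc : c ∉ Set.range (R.unit.app m).toOrderHom) : a = c :=
  R.eq_of_notMem_range (fun ⟨_, hb⟩ => hc (R.mem_range_of_le (hb.trans_le h))) hc

theorem map_le_incl {f : m ⟶ n} {k : Ord n} (h : ∀ b, f.toOrderHom b ≤ k)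
    (a : Ord (R.functor.obj m)) : (R.functor.map f).toOrderHom a ≤ (R.incl n).obj k := by
  by_cases ha : a ∈ Set.range (R.unit.app m).toOrderHom
  · obtain ⟨b, rfl⟩ := ha
    exact (R.map_incl f b).trans_le ((R.unit.app n).toOrderHom.monotone (h b))
  · by_contra hlt
    exact R.map_notMem_range f ha (R.mem_range_of_le (not_le.1 hlt).le)

theorem map_eq_self {f : m ⟶ m} {k : Ord m} (h : ∀ b ≤ k, f.toOrderHom b = b)
    {a : Ord (R.functor.obj m)} (ha : a ≤ (R.incl m).obj k) :
    (R.functor.map f).toOrderHom a = a := by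
  by_cases hr : a ∈ Set.range (R.unit.app m).toOrderHom
  · obtain ⟨b, rfl⟩ := hr
    exact (R.map_incl f b).trans (congrArg _ (h b (le_of_incl_le ha)))
  · exact R.eq_of_notMem_range (R.map_notMem_range f hr) hr

end RowExtension

/-! ## Compatible families of grids -/

namespace RowExtension

variable (R : RowExtension) {m : SimplexCategory} {y : DeltaSq}

/-- The shape of the diagrams which correspond to compatible families of grids: the pairs `(a, b)`
of a row and a column with `a ≤ b`. -/
abbrev Shape (m : SimplexCategory) : Type := Staircase (R.incl m)

theorem map_joinInl_le (β : join.obj y ⟶ m) (a : Ord (R.functor.obj y.1)) :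
    (R.functor.map (joinInl y ≫ β)).toOrderHom a ≤ (R.incl m).obj (cutPoint β) :=
  map_le_incl (joinComponents_fst_le β) a

/-- The grid of shape `[q] × [r]` in the shape at `[m]` given by a map `[q + 1 + r] ⟶ [m]`. -/
def gridToShape (β : join.obj y ⟶ m) : Grid (R.shift.obj y) ⥤ R.Shape m where
  obj z := .mk ((R.functor.map (joinInl y ≫ β)).toOrderHom z.1) ((joinInr y ≫ β).toOrderHom z.2)
    ((R.map_joinInl_le β z.1).trans
      ((R.unit.app m).toOrderHom.monotone (le_joinComponents_snd β z.2)))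
  map f := Staircase.homMk ((R.functor.map (joinInl y ≫ β)).toOrderHom.monotone (leOfHom f.1))
    ((joinInr y ≫ β).toOrderHom.monotone (leOfHom f.2))

theorem gridToShape_window (β : join.obj y ⟶ m) (z : Grid (R.shift.obj y)) :
    Staircase.window (R.incl m) (cutPoint β) ((R.gridToShape β).obj z) :=
  ⟨R.map_joinInl_le β z.1, le_joinComponents_snd β z.2⟩

theorem window_ι_comp_gridToShape_cut (k : Ord m) :
    (Staircase.window (R.incl m) k).ι ⋙ Staircase.toRect (R.incl m) ⋙ R.gridToShape (cut k) =
      (Staircase.window (R.incl m) k).ι :=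
  CategoryTheory.Functor.ext
    (fun z => Staircase.ext
      (show (R.functor.map (joinInl (m, m) ≫ cut k)).toOrderHom z.obj.left = z.obj.left by
        rw [joinInl_cut]
        exact map_eq_self (fun _ h => min_eq_left h) z.property.1)
      (show (joinInr (m, m) ≫ cut k).toOrderHom z.obj.right = z.obj.right by
        rw [joinInr_cut]
        exact max_eq_left z.property.2))
    (fun _ _ _ => Subsingleton.elim _ _)

end RowExtension

section GridFamily

variable {R : RowExtension} {m : SimplexCategory} {C : Type u} [Category.{v} C]

variable (R m C) in
/-- A grid for each map `[q + 1 + r] ⟶ [m]`, compatible with restrictions. -/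
structure GridFamily where
  grid {y : DeltaSq} (β : join.obj y ⟶ m) : Grid (R.shift.obj y) ⥤ C
  gridMap_comp_grid {x y : DeltaSq} (g : x ⟶ y) (β : join.obj y ⟶ m) :
    gridMap (R.shift.map g) ⋙ grid β = grid (join.map g ≫ β)

namespace GridFamily

theorem window_inf_comp_grid_cut (F : GridFamily R m C) {k l : Ord m} (hkl : k ≤ l) :
    (Staircase.window (R.incl m) k ⊓ Staircase.window (R.incl m) l).ι ⋙
        Staircase.toRect (R.incl m) ⋙ F.grid (cut k) =
      (Staircase.window (R.incl m) k ⊓ Staircase.window (R.incl m) l).ι ⋙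
        Staircase.toRect (R.incl m) ⋙ F.grid (cut l) := by
  -- On the intersection of the windows at `k ≤ l`, the identity is the restriction of
  -- `(min(-, k), max(-, l))`, and the ordinal sum of the latter does not see the difference
  -- between `cut k` and `cut l`.
  let g : ((m, m) : DeltaSq) ⟶ (m, m) := (minHom k, maxHom l)
  let W := Staircase.window (R.incl m) k ⊓ Staircase.window (R.incl m) l
  have hg : (W.ι ⋙ Staircase.toRect (R.incl m)) ⋙ gridMap (R.shift.map g) =
      W.ι ⋙ Staircase.toRect (R.incl m) :=
    CategoryTheory.Functor.ext
      (fun z => Prod.ext (RowExtension.map_eq_self (fun _ h => min_eq_left h) z.property.1.1)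
        (max_eq_left z.property.2.2))
      (fun _ _ _ => Prod.ext (Subsingleton.elim _ _) (Subsingleton.elim _ _))
  have hcut : join.map g ≫ cut k = join.map g ≫ cut l :=
    join_map_comp_cut_congr g (fun a => min_le_right a k)
      (fun b => hkl.trans (le_max_right b l)) (fun a => (min_le_right a k).trans hkl)
      (fun b => le_max_right b l)
  calc (W.ι ⋙ Staircase.toRect (R.incl m)) ⋙ F.grid (cut k)
    _ = (W.ι ⋙ Staircase.toRect (R.incl m)) ⋙ gridMap (R.shift.map g) ⋙ F.grid (cut k) := by
      rw [← CategoryTheory.Functor.assoc, hg]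
    _ = (W.ι ⋙ Staircase.toRect (R.incl m)) ⋙ gridMap (R.shift.map g) ⋙ F.grid (cut l) := by
      rw [F.gridMap_comp_grid, F.gridMap_comp_grid, hcut]
    _ = (W.ι ⋙ Staircase.toRect (R.incl m)) ⋙ F.grid (cut l) := by
      rw [← CategoryTheory.Functor.assoc, hg]

/-- The `k`-th diagram is the grid given by the cut at `k`. -/
def cocycle (F : GridFamily R m C) : StaircaseCocycle (R.incl m) C where
  diagram k := F.grid (cut k)
  agree k l := by
    obtain hkl | hlk := le_total k l
    · exact F.window_inf_comp_grid_cut hkl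
    · rw [inf_comm]
      exact (F.window_inf_comp_grid_cut hlk).symm

/-- The diagram glued from a compatible family of grids. -/
def glue (F : GridFamily R m C) : R.Shape m ⥤ C :=
  F.cocycle.glue

theorem gridToShape_comp_glue (F : GridFamily R m C) {y : DeltaSq} (β : join.obj y ⟶ m) :
    R.gridToShape β ⋙ F.glue = F.grid β :=
  let toWindow := (Staircase.window (R.incl m) (cutPoint β)).lift (R.gridToShape β)
    (R.gridToShape_window β)
  calc toWindow ⋙ (Staircase.window (R.incl m) (cutPoint β)).ι ⋙ F.glue
    _ = toWindow ⋙ (Staircase.window (R.incl m) (cutPoint β)).ι ⋙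
        Staircase.toRect (R.incl m) ⋙ F.grid (cut (cutPoint β)) :=
      congrArg (toWindow ⋙ ·) (F.cocycle.window_ι_comp_glue (cutPoint β))
    _ = gridMap (R.shift.map (joinComponents β)) ⋙ F.grid (cut (cutPoint β)) := rfl
    _ = F.grid β := by rw [F.gridMap_comp_grid, joinComponents_map_comp_cut]

end GridFamily

theorem shape_functor_ext {F G : R.Shape m ⥤ C}
    (h : ∀ k, R.gridToShape (cut k) ⋙ F = R.gridToShape (cut k) ⋙ G) : F = G :=
  Staircase.functor_ext fun k => by
    have hk := R.window_ι_comp_gridToShape_cut k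
    rw [← hk, CategoryTheory.Functor.assoc, CategoryTheory.Functor.assoc,
      CategoryTheory.Functor.assoc, CategoryTheory.Functor.assoc, h]

end GridFamily

/-! ## Natural transformations as diagrams of arrows -/

section NatTransToArrow

variable {D : Type} [SmallCategory D] {C : Type u} [Category.{v} C] {F G : D ⥤ C}

/-- A natural transformation, regarded as a diagram of arrows. An equality of such diagrams
compares transformations between functors which are only propositionally equal. -/
@[simps]
def natTransToArrow (α : F ⟶ G) : D ⥤ Arrow C where
  obj d := Arrow.mk (α.app d)
  map f := Arrow.homMk (F.map f) (G.map f) (α.naturality f)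

theorem natTransToArrow_injective :
    Function.Injective (natTransToArrow : (F ⟶ G) → D ⥤ Arrow C) := fun _ _ h =>
  NatTrans.ext (funext fun d => (Arrow.mk_inj _ _).1 (Functor.congr_obj h d))

theorem exists_natTransToArrow_eq {H : D ⥤ Arrow C} (hF : H ⋙ Arrow.leftFunc = F)
    (hG : H ⋙ Arrow.rightFunc = G) : ∃ τ : F ⟶ G, natTransToArrow τ = H := by
  subst hF hG
  exact ⟨Functor.whiskerLeft H Arrow.leftToRight, rfl⟩

variable {P : ObjectProperty (D ⥤ C)}

theorem natTransToArrow_congr {X Y X' Y' : IsoFull P} {a : X ⟶ Y} {b : X' ⟶ Y'}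
    (hX : X = X') (hY : Y' = Y) (h : a = eqToHom hX ≫ b ≫ eqToHom hY) :
    natTransToArrow (Iso.hom a) = natTransToArrow (Iso.hom b) := by
  subst hX hY
  rw [h, eqToHom_refl, eqToHom_refl, Category.id_comp, Category.comp_id]

theorem isoFull_hom_ext {X Y : IsoFull P} {a b : X ⟶ Y}
    (h : natTransToArrow (Iso.hom a) = natTransToArrow (Iso.hom b)) : a = b :=
  Iso.ext (natTransToArrow_injective h)

end NatTransToArrow

section ShapeHom

variable {R : RowExtension} {m : SimplexCategory} {C : Type u} [Category.{v} C]
variable {F G : R.Shape m ⥤ C}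

theorem exists_gridToShape_cut_obj_eq (x : R.Shape m) :
    ∃ (k : Ord m) (z : Grid (R.shift.obj (m, m))), (R.gridToShape (cut k)).obj z = x :=
  ⟨x.right, (x.left, x.right), Functor.congr_obj (R.window_ι_comp_gridToShape_cut x.right)
    ⟨x, leOfHom x.hom, le_rfl⟩⟩

theorem shape_natTrans_ext {σ τ : F ⟶ G} (h : ∀ k, Functor.whiskerLeft (R.gridToShape (cut k)) σ =
    Functor.whiskerLeft (R.gridToShape (cut k)) τ) : σ = τ :=
  NatTrans.ext (funext fun x => by
    obtain ⟨k, z, rfl⟩ := exists_gridToShape_cut_obj_eq x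
    exact NatTrans.congr_app (h k) z)

theorem GridFamily.exists_natTrans (H : GridFamily R m (Arrow C))
    (hF : ∀ {y : DeltaSq} (β : join.obj y ⟶ m), H.grid β ⋙ Arrow.leftFunc = R.gridToShape β ⋙ F)
    (hG : ∀ {y : DeltaSq} (β : join.obj y ⟶ m),
      H.grid β ⋙ Arrow.rightFunc = R.gridToShape β ⋙ G) :
    ∃ τ : F ⟶ G, ∀ {y : DeltaSq} (β : join.obj y ⟶ m),
      R.gridToShape β ⋙ natTransToArrow τ = H.grid β := by
  obtain ⟨τ, hτ⟩ := exists_natTransToArrow_eq (H := H.glue) (F := F) (G := G)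
    (shape_functor_ext fun k => by
      rw [← CategoryTheory.Functor.assoc, H.gridToShape_comp_glue, hF])
    (shape_functor_ext fun k => by
      rw [← CategoryTheory.Functor.assoc, H.gridToShape_comp_glue, hG])
  exact ⟨τ, fun β => by rw [hτ, H.gridToShape_comp_glue]⟩

end ShapeHom

/-! ## Admissible diagrams on staircases -/

section Admissible

variable {A : Type u} [Category.{v} A] [Preadditive A] [HasFiniteBiproducts A] [ExactCategory A]
variable {R : RowExtension} {m : SimplexCategory}

theorem isAdmissible_of_window {P J : Type} [Preorder P] [Preorder J] {η : J ⥤ P}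
    {F : Staircase η ⥤ A}
    (h : ∀ k, IsAdmissible (fun x => x.obj.left) (fun x => x.obj.right)
      ((Staircase.window η k).ι ⋙ F)) :
    IsAdmissible (fun x => x.left) (fun x => x.right) F := by
  -- A square lies in the window at the column of its upper left corner.
  have self_mem (x : Staircase η) : Staircase.window η x.right x := ⟨leOfHom x.hom, le_rfl⟩
  refine ⟨fun {x y} a hxy => ?_, fun {x y} a hxy => ?_,
    fun {x y z w} a b c d sq hxy hzw hxz hyw => ?_⟩
  · have hy : Staircase.window η x.right y := ⟨hxy.ge.trans (leOfHom x.hom), leOfHom a.right⟩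
    exact (h x.right).horizontal (x := ⟨x, self_mem x⟩) (y := ⟨y, hy⟩) (ObjectProperty.homMk a) hxy
  · have hy : Staircase.window η x.right y := hxy ▸ self_mem y
    exact (h x.right).vertical (x := ⟨x, self_mem x⟩) (y := ⟨y, hy⟩) (ObjectProperty.homMk a) hxy
  · have hy : Staircase.window η x.right y := ⟨hxy.ge.trans (leOfHom x.hom), leOfHom a.right⟩
    have hz : Staircase.window η x.right z := hxz ▸ self_mem z
    have hw : Staircase.window η x.right w :=
      ⟨hzw.ge.trans hz.1, hz.2.trans (leOfHom d.right)⟩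
    exact (h x.right).square (x := ⟨x, self_mem x⟩) (y := ⟨y, hy⟩) (z := ⟨z, hz⟩) (w := ⟨w, hw⟩)
      (ObjectProperty.homMk a) (ObjectProperty.homMk b) (ObjectProperty.homMk c)
      (ObjectProperty.homMk d) (ObjectProperty.hom_ext _ sq) hxy hzw hxz hyw

theorem isAdmissible_of_gridToShape_cut {F : R.Shape m ⥤ A}
    (h : ∀ k, gridProp A _ (R.gridToShape (cut k) ⋙ F)) :
    IsAdmissible (fun x => x.left) (fun x => x.right) F :=
  isAdmissible_of_window fun k => by
    rw [← R.window_ι_comp_gridToShape_cut k]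
    exact (h k).comp ((Staircase.window (R.incl m) k).ι ⋙ Staircase.toRect (R.incl m))
      (fun _ _ e => e) (fun _ _ e => e)

end Admissible

/-! ## Nerves with extended rows -/

section ShiftedNerve

variable {A : Type u} [Category.{v} A] [Preadditive A] [HasFiniteBiproducts A] [ExactCategory A]
variable {R : RowExtension} {m : SimplexCategory} {Z : Grpd.{v, max v u}}

/-- The exact nerve with rows indexed through a row extension, and with augmentation `ε`. The exact
nerve itself and its initial path construction are definitionally of this form. -/
abbrev shiftedNerve (ε : Z ⟶ (nerveBisimplicial A).obj (op (R.shift.obj zz))) :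
    Preaug Grpd.{v, max v u} :=
  Preaug.mk (R.shift.op ⋙ nerveBisimplicial A) Z ε

/-- The augmentation is a subgroupoid, not necessarily full, of the groupoid of those grids which
are zero at the corner of the staircase. -/
structure IsZeroAugmentation (ε : Z ⟶ (nerveBisimplicial A).obj (op (R.shift.obj zz))) : Prop where
  injective : Function.Injective ε.obj
  faithful : Functor.Faithful ε
  isZero : ∀ z, IsZero (IsoFull.obj (P := gridProp A (R.shift.obj zz)) (ε.obj z) |>.obj
    ((R.incl ⦋0⦌).obj 0, 0))

variable {ε : Z ⟶ (nerveBisimplicial A).obj (op (R.shift.obj zz))}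
variable {x x' : GrpdLimit (genDiagram (shiftedNerve ε) (op m))}

namespace GridFamily

/-- The compatible family of grids underlying an object of the limit. -/
def ofObj (x : GrpdLimit (genDiagram (shiftedNerve ε) (op m))) : GridFamily R m A where
  grid {y} β := IsoFull.obj (P := gridProp A (R.shift.obj y)) (x.obj (gridIndex β))
  gridMap_comp_grid {y _} g β :=
    congrArg (IsoFull.obj (P := gridProp A (R.shift.obj y))) (x.compat (gridIndexHom g β))

/-- The isomorphisms of grids which are the components of a morphism of the limit. -/
abbrev gridIso (a : x ⟶ x') {y : DeltaSq} (β : join.obj y ⟶ m) :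
    (ofObj x).grid β ≅ (ofObj x').grid β :=
  GrpdLimit.Hom.app a (gridIndex β)

/-- The compatible family of grids of arrows underlying a morphism of the limit. -/
def ofHom (a : x ⟶ x') : GridFamily R m (Arrow A) where
  grid β := natTransToArrow (gridIso a β).hom
  gridMap_comp_grid {y _} g β := natTransToArrow_congr (P := gridProp A (R.shift.obj y))
    (x.compat (gridIndexHom g β)) (x'.compat (gridIndexHom g β)).symm
    (GrpdLimit.Hom.compat a (gridIndexHom g β))

theorem isAdmissible_glue_ofObj :
    IsAdmissible (fun z => z.left) (fun z => z.right) (ofObj x).glue :=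
  isAdmissible_of_gridToShape_cut fun k => by
    rw [gridToShape_comp_glue]
    exact IsoFull.property (P := gridProp A (R.shift.obj (m, m))) (x.obj (gridIndex (cut k)))

theorem isZero_glue_ofObj (hε : IsZeroAugmentation ε) {z : R.Shape m}
    (hz : z.left = (R.incl m).obj z.right) : IsZero ((ofObj x).glue.obj z) := by
  let i : (⦋0⦌ : SimplexCategory) ⟶ m := SimplexCategory.const ⦋0⦌ m z.right
  let β : join.obj zz ⟶ m := p.map (WithTerminal.homFrom zz) ≫ i
  have hβ : (R.gridToShape β).obj ((R.incl ⦋0⦌).obj 0, 0) = z :=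
    Staircase.ext ((R.map_incl _ _).trans hz.symm) rfl
  have hx : (ofObj x).grid β = IsoFull.obj (P := gridProp A (R.shift.obj zz))
      ((shiftedNerve ε).aug.obj (x.obj (augIndex i))) :=
    congrArg (IsoFull.obj (P := gridProp A (R.shift.obj zz))) (x.compat (augIndexHom i)).symm
  rw [← hβ]
  change IsZero ((R.gridToShape β ⋙ (ofObj x).glue).obj _)
  rw [gridToShape_comp_glue, hx, Preaug.mk_aug]
  exact hε.isZero _

theorem exists_iso_of_hom (a : x ⟶ x') {F G : R.Shape m ⥤ A}
    (hF : ∀ {y : DeltaSq} (β : join.obj y ⟶ m), (ofObj x).grid β = R.gridToShape β ⋙ F)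
    (hG : ∀ {y : DeltaSq} (β : join.obj y ⟶ m), (ofObj x').grid β = R.gridToShape β ⋙ G) :
    ∃ τ : F ≅ G, ∀ {y : DeltaSq} (β : join.obj y ⟶ m),
      R.gridToShape β ⋙ natTransToArrow τ.hom = (ofHom a).grid β := by
  obtain ⟨τ, hτ⟩ := (ofHom a).exists_natTrans hF hG
  have (z : R.Shape m) : IsIso (τ.app z) := by
    obtain ⟨k, w, rfl⟩ := exists_gridToShape_cut_obj_eq z
    have h : Arrow.mk (τ.app ((R.gridToShape (cut k)).obj w)) = ((ofHom a).grid (cut k)).obj w :=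
      CategoryTheory.Functor.congr_obj (hτ (cut k)) w
    change MorphismProperty.isomorphisms A (Arrow.mk _).hom
    rw [h]
    exact inferInstanceAs (IsIso ((gridIso a (cut k)).hom.app w))
  have := NatIso.isIso_of_isIso_app τ
  exact ⟨asIso τ, hτ⟩

end GridFamily

end ShiftedNerve

/-! ## Extension by zero -/

section ExtensionByZero

variable {S D : Type} [SmallCategory S] [SmallCategory D] {C : Type u} [Category.{v} C]

/-- A functor which takes zero objects as values outside the image of `i`. -/
def VanishesOutside (i : S ⥤ D) (F : D ⥤ C) : Prop :=
  ∀ d, d ∉ Set.range i.obj → IsZero (F.obj d)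

/-- A functor whose image is closed under targets of morphisms. -/
def IsCosieve (i : S ⥤ D) : Prop :=
  ∀ {s : S} {d : D}, (i.obj s ⟶ d) → d ∈ Set.range i.obj

instance [Quiver.IsThin S] : Quiver.IsThin (WithInitial S) := fun x y =>
  match x, y with
  | .of s, .of s' => inferInstanceAs (Subsingleton (s ⟶ s'))
  | .of _, .star => inferInstanceAs (Subsingleton PEmpty)
  | .star, _ => inferInstanceAs (Subsingleton PUnit)

theorem exists_comp_eq_withInitial_incl [Quiver.IsThin S] {i : S ⥤ D} [i.Full]
    (hi : Function.Injective i.obj) (hi' : IsCosieve i) :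
    ∃ r : D ⥤ WithInitial S, i ⋙ r = WithInitial.incl ∧
      ∀ d, d ∉ Set.range i.obj → r.obj d = WithInitial.star := by
  classical
  let r (d : D) : WithInitial S :=
    if h : d ∈ Set.range i.obj then WithInitial.of h.choose else WithInitial.star
  have r_obj (s : S) : r (i.obj s) = WithInitial.of s :=
    have h : i.obj s ∈ Set.range i.obj := ⟨s, rfl⟩
    (dif_pos h).trans (congrArg WithInitial.of (hi h.choose_spec))
  have r_star (d : D) (hd : d ∉ Set.range i.obj) : r d = WithInitial.star := dif_neg hd
  have r_map {d d' : D} (f : d ⟶ d') : Nonempty (r d ⟶ r d') := by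
    by_cases hd : d ∈ Set.range i.obj
    · obtain ⟨s, rfl⟩ := hd
      obtain ⟨s', rfl⟩ := hi' f
      rw [r_obj, r_obj]
      exact ⟨WithInitial.incl.map (i.preimage f)⟩
    · rw [r_star d hd]
      exact ⟨WithInitial.starInitial.to _⟩
  let R : D ⥤ WithInitial S :=
    { obj := r
      map := fun f => (r_map f).some
      map_id := fun _ => Subsingleton.elim _ _
      map_comp := fun _ _ => Subsingleton.elim _ _ }
  exact ⟨R, CategoryTheory.Functor.ext r_obj fun _ _ _ => Subsingleton.elim _ _, r_star⟩

theorem exists_extension_vanishesOutside [HasZeroObject C] [Quiver.IsThin S] {i : S ⥤ D} [i.Full]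
    (hi : Function.Injective i.obj) (hi' : IsCosieve i) (F : S ⥤ C) :
    ∃ G : D ⥤ C, i ⋙ G = F ∧ VanishesOutside i G := by
  obtain ⟨Z, hZ⟩ := HasZeroObject.zero (C := C)
  obtain ⟨r, hr, hr'⟩ := exists_comp_eq_withInitial_incl hi hi'
  refine ⟨r ⋙ WithInitial.liftToInitial F hZ.isInitial, ?_, fun d hd => ?_⟩
  · rw [← CategoryTheory.Functor.assoc, hr]
    rfl
  · change IsZero ((WithInitial.liftToInitial F hZ.isInitial).obj (r.obj d))
    rw [hr' d hd]
    exact hZ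

variable {i : S ⥤ D} {F G : D ⥤ C}

theorem VanishesOutside.hom_ext (hF : VanishesOutside i F) {σ τ : F ⟶ G}
    (h : Functor.whiskerLeft i σ = Functor.whiskerLeft i τ) : σ = τ :=
  NatTrans.ext (funext fun d => by
    by_cases hd : d ∈ Set.range i.obj
    · obtain ⟨s, rfl⟩ := hd
      exact NatTrans.congr_app h s
    · exact (hF d hd).eq_of_src _ _)

theorem VanishesOutside.exists_iso [i.Full] (hi : Function.Injective i.obj)
    (hF : VanishesOutside i F) (hG : VanishesOutside i G) (τ : i ⋙ F ≅ i ⋙ G) :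
    ∃ σ : F ≅ G, Functor.whiskerLeft i σ.hom = τ.hom := by
  have (d : D) : ∃ e : F.obj d ≅ G.obj d,
      ∀ s, i.obj s = d → Arrow.mk e.hom = Arrow.mk (τ.hom.app s) := by
    by_cases hd : d ∈ Set.range i.obj
    · obtain ⟨s, rfl⟩ := hd
      exact ⟨τ.app s, fun s' hs => by rw [hi hs]; rfl⟩
    · exact ⟨(hF d hd).iso (hG d hd), fun s hs => (hd ⟨s, hs⟩).elim⟩
  choose e he using this
  have he' (s : S) : (e (i.obj s)).hom = τ.hom.app s := (Arrow.mk_inj _ _).1 (he _ s rfl)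
  refine ⟨NatIso.ofComponents e fun {d d'} f => ?_, NatTrans.ext (funext he')⟩
  by_cases hd : d ∈ Set.range i.obj
  · obtain ⟨s, rfl⟩ := hd
    by_cases hd' : d' ∈ Set.range i.obj
    · obtain ⟨s', rfl⟩ := hd'
      obtain ⟨f, rfl⟩ := i.map_surjective f
      rw [he', he']
      exact τ.hom.naturality f
    · exact (hG d' hd').eq_of_tgt _ _
  · exact (hF d hd).eq_of_src _ _

end ExtensionByZero

/-! ## From staircases to arrow categories -/

section Exact

variable {A : Type u} [Category.{v} A] [Preadditive A] [HasFiniteBiproducts A] [ExactCategory A]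

theorem seq_zero_id {Z X : A} (hZ : IsZero Z) :
    ExactCategory.seq (ShortComplex.mk (0 : Z ⟶ X) (𝟙 X) zero_comp) := by
  obtain ⟨Y, g, q, pb, K, i, w, h⟩ := ExactCategory.pullback (0 : X ⟶ Z) (𝟙 Z)
    (ExactCategory.admEpi_id_zero Z hZ)
  have : IsIso q := pb.isIso_snd_of_isIso
  obtain ⟨l⟩ := ExactCategory.isKernel _ h
  have : Mono i := Fork.IsLimit.mono l
  have hK : IsZero K := (IsZero.iff_id_eq_zero K).2 (by
    rw [← cancel_mono i, ← cancel_mono q, Category.assoc, w, comp_zero, zero_comp, zero_comp])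
  exact ExactCategory.of_iso (S := ShortComplex.mk i q w) (ShortComplex.isoMk (hK.iso hZ) (asIso q)
    (Iso.refl X) (hK.eq_of_src _ _) rfl) h

theorem M_of_isZero {Z X : A} (hZ : IsZero Z) (i : Z ⟶ X) : M A i := by
  rw [hZ.eq_of_src i 0]
  exact ⟨X, 𝟙 X, _, seq_zero_id hZ⟩

theorem E_id (X : A) : E A (𝟙 X) := ⟨_, 0, _, seq_zero_id (isZero_zero A)⟩

end Exact

namespace RowExtension

variable (R : RowExtension) (m : SimplexCategory)

/-- The functor to `Ar` of the extended ordinal, which sends `(a, b)` to `a ≤ b`. -/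
def shapeToAr : R.Shape m ⥤ Ar (R.functor.obj m) :=
  Comma.preRight (𝟭 _) (R.incl m) (𝟭 _)

variable {R m}

instance : (R.shapeToAr m).Full where
  map_surjective f := ⟨Staircase.homMk (leOfHom f.left) (le_of_incl_le (leOfHom f.right)),
    ar_hom_ext _ _⟩

theorem shapeToAr_obj_injective : Function.Injective (R.shapeToAr m).obj := fun _ _ h =>
  Staircase.ext (congrArg (fun x : Ar (R.functor.obj m) => x.left) h)
    (R.injective m (congrArg (fun x : Ar (R.functor.obj m) => x.right) h))

theorem mem_range_shapeToAr_obj {x : Ar (R.functor.obj m)} :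
    x ∈ Set.range (R.shapeToAr m).obj ↔ x.right ∈ Set.range (R.unit.app m).toOrderHom := by
  constructor
  · rintro ⟨z, rfl⟩
    exact ⟨z.right, rfl⟩
  · rintro ⟨b, hb⟩
    exact ⟨.mk x.left b ((leOfHom x.hom).trans hb.ge), ar_ext rfl hb⟩

theorem isCosieve_shapeToAr : IsCosieve (R.shapeToAr m) := fun f =>
  mem_range_shapeToAr_obj.2 (R.mem_range_of_le (leOfHom f.right))

theorem shapeToAr_obj_surjective (h : Function.Surjective (R.unit.app m).toOrderHom) :
    Function.Surjective (R.shapeToAr m).obj := fun _ =>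
  mem_range_shapeToAr_obj.2 (h _)

/-- The arrows outside of the image are identities of the added vertex. -/
theorem left_eq_right_of_notMem_range {x : Ar (R.functor.obj m)}
    (hx : x ∉ Set.range (R.shapeToAr m).obj) : x.left = x.right :=
  eq_of_le_of_notMem_range (leOfHom x.hom) fun h => hx (mem_range_shapeToAr_obj.2 h)

theorem eq_of_right_eq_of_notMem_range {x y : Ar (R.functor.obj m)}
    (hx : x ∉ Set.range (R.shapeToAr m).obj) (h : x.right = y.right) : x = y := by
  have hy : y ∉ Set.range (R.shapeToAr m).obj := fun hy =>
    hx (mem_range_shapeToAr_obj.2 (h ▸ mem_range_shapeToAr_obj.1 hy))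
  exact ar_ext ((left_eq_right_of_notMem_range hx).trans
    (h.trans (left_eq_right_of_notMem_range hy).symm)) h

variable {A : Type u} [Category.{v} A] [Preadditive A] [HasFiniteBiproducts A] [ExactCategory A]

theorem isAdmissible_of_shapeToAr {F : Ar (R.functor.obj m) ⥤ A}
    (h : IsAdmissible (fun z => z.left) (fun z => z.right) (R.shapeToAr m ⋙ F))
    (hF : VanishesOutside (R.shapeToAr m) F) :
    IsAdmissible (fun x => x.left) (fun x => x.right) F := by
  refine ⟨fun {x y} a hxy => ?_, fun {x y} a hxy => ?_,
    fun {x y z w} a b c d sq hxy hzw hxz hyw => ?_⟩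
  · by_cases hx : x ∈ Set.range (R.shapeToAr m).obj
    · obtain ⟨x, rfl⟩ := hx
      obtain ⟨y, rfl⟩ := isCosieve_shapeToAr a
      obtain ⟨a, rfl⟩ := (R.shapeToAr m).map_surjective a
      exact h.horizontal a hxy
    · exact M_of_isZero (hF x hx) _
  · by_cases hx : x ∈ Set.range (R.shapeToAr m).obj
    · obtain ⟨x, rfl⟩ := hx
      obtain ⟨y, rfl⟩ := isCosieve_shapeToAr a
      obtain ⟨a, rfl⟩ := (R.shapeToAr m).map_surjective a
      exact h.vertical a (R.injective m hxy)
    · obtain rfl := eq_of_right_eq_of_notMem_range hx hxy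
      rw [ar_hom_ext a (𝟙 x), F.map_id]
      exact E_id _
  · by_cases hx : x ∈ Set.range (R.shapeToAr m).obj
    · obtain ⟨x, rfl⟩ := hx
      obtain ⟨y, rfl⟩ := isCosieve_shapeToAr a
      obtain ⟨z, rfl⟩ := isCosieve_shapeToAr b
      obtain ⟨w, rfl⟩ := isCosieve_shapeToAr c
      obtain ⟨a, rfl⟩ := (R.shapeToAr m).map_surjective a
      obtain ⟨b, rfl⟩ := (R.shapeToAr m).map_surjective b
      obtain ⟨c, rfl⟩ := (R.shapeToAr m).map_surjective c
      obtain ⟨d, rfl⟩ := (R.shapeToAr m).map_surjective d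
      exact h.square a b c d (Subsingleton.elim _ _) hxy hzw (R.injective m hxz)
        (R.injective m hyw)
    · obtain rfl := eq_of_right_eq_of_notMem_range hx hxz
      obtain rfl : y = w := ar_ext (hxy.symm.trans hzw) hyw
      rw [ar_hom_ext b (𝟙 x), ar_hom_ext c (𝟙 y), ar_hom_ext d a, F.map_id, F.map_id]
      have comm : CommSq (F.map a) (𝟙 (F.obj x)) (𝟙 (F.obj y)) (F.map a) := ⟨by simp⟩
      exact ⟨IsPullback.of_vert_isIso comm, IsPushout.of_vert_isIso comm⟩

theorem arProp_of_shapeToAr {F : Ar (R.functor.obj m) ⥤ A}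
    (h : IsAdmissible (fun z => z.left) (fun z => z.right) (R.shapeToAr m ⋙ F))
    (hz : ∀ z : R.Shape m, z.left = (R.incl m).obj z.right → IsZero ((R.shapeToAr m ⋙ F).obj z))
    (hF : VanishesOutside (R.shapeToAr m) F) : arProp A (R.functor.obj m) F := by
  refine ⟨isAdmissible_of_shapeToAr h hF, fun x hx => ?_⟩
  by_cases hr : x ∈ Set.range (R.shapeToAr m).obj
  · obtain ⟨z, rfl⟩ := hr
    exact hz z hx
  · exact hF x hr

theorem vanishesOutside_of_arProp {F : Ar (R.functor.obj m) ⥤ A}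
    (hF : arProp A (R.functor.obj m) F) : VanishesOutside (R.shapeToAr m) F := fun x hx =>
  hF.2 x (left_eq_right_of_notMem_range hx)

end RowExtension

/-! ## The comparison maps -/

namespace RowExtension

variable (R : RowExtension) {m : SimplexCategory} {y : DeltaSq}

/-- The inclusion of a grid, with extended rows, into `Ar` of the extended ordinal sum. -/
def gridToAr (y : DeltaSq) : Grid (R.shift.obj y) ⥤ Ar (R.functor.obj (join.obj y)) :=
  R.gridToShape (𝟙 (join.obj y)) ⋙ R.shapeToAr (join.obj y)

theorem gridToAr_comp_arMap (β : join.obj y ⟶ m) :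
    R.gridToAr y ⋙ arMap (R.functor.map β) = R.gridToShape β ⋙ R.shapeToAr m :=
  CategoryTheory.Functor.ext
    (fun z => ar_ext
      (show (R.functor.map (joinInl y ≫ 𝟙 _) ≫ R.functor.map β).toOrderHom z.1 =
          (R.functor.map (joinInl y ≫ β)).toOrderHom z.1 by
        rw [← R.functor.map_comp, Category.comp_id])
      (R.map_incl β ((joinInr y).toOrderHom z.2)))
    (fun _ _ _ => ar_hom_ext _ _)

variable (A : Type u) [Category.{v} A] [Preadditive A] [HasFiniteBiproducts A] [ExactCategory A]

/-- Restriction of diagrams along `gridToAr`. -/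
def arRestrict (y : DeltaSq) :
    IsoFull (arProp A (R.functor.obj (join.obj y))) ⥤ IsoFull (gridProp A (R.shift.obj y)) :=
  IsoFull.map ((Functor.whiskeringLeft _ _ A).obj (R.gridToAr y)) fun _ hF => hF.1.comp _
    (fun _ _ h => congrArg (R.functor.map (joinInl y ≫ 𝟙 _)).toOrderHom h)
    (fun _ _ h => congrArg (joinInr y ≫ 𝟙 (join.obj y) ≫ R.unit.app _).toOrderHom h)

end RowExtension

theorem functor_eq_of_comp_eq {S T D : Type*} [Category* S] [Category* T] [Category* D] (H : S ⥤ T)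
    [H.Full] (hH : Function.Surjective H.obj) {F G : T ⥤ D} (h : H ⋙ F = H ⋙ G) : F = G := by
  refine Arrow.functor_ext fun {X Y} f => ?_
  obtain ⟨X, rfl⟩ := hH X
  obtain ⟨Y, rfl⟩ := hH Y
  obtain ⟨f, rfl⟩ := H.map_surjective f
  exact congrArg (fun K : S ⥤ D => Arrow.mk (K.map f)) h

theorem IsoFull.obj_injective {C : Type u} [Category.{v} C] {P : ObjectProperty C} :
    Function.Injective (IsoFull.obj (P := P)) := by
  rintro ⟨_, _⟩ ⟨_, _⟩ h
  cases h
  rfl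

section AdjunctToLimit

variable {A : Type u} [Category.{v} A] [Preadditive A] [HasFiniteBiproducts A] [ExactCategory A]
variable {R : RowExtension} {m : SimplexCategory} {Z : Grpd.{v, max v u}}
variable {ε : Z ⟶ (nerveBisimplicial A).obj (op (R.shift.obj zz))}
variable {β : p.op ⋙ R.functor.op ⋙ exactS A ⟶ shiftedNerve ε}
variable {X X' : IsoFull (arProp A (R.functor.obj m))}

open GridFamily

theorem grid_ofObj_adjunctToLimit (hβ : ∀ y, β.app (op (WithTerminal.of y)) = R.arRestrict A y)
    (X : IsoFull (arProp A (R.functor.obj m))) {y : DeltaSq} (b : join.obj y ⟶ m) :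
    (ofObj ((adjunctToLimit β (op m)).obj X)).grid b =
      R.gridToShape b ⋙ R.shapeToAr m ⋙ X.obj := by
  change IsoFull.obj (P := gridProp A (R.shift.obj y)) ((β.app (op (WithTerminal.of y))).obj
    (((exactS A).map (R.functor.map b).op).obj X)) = _
  rw [hβ]
  exact congrArg (· ⋙ X.obj) (R.gridToAr_comp_arMap b)

theorem grid_ofHom_adjunctToLimit (hβ : ∀ y, β.app (op (WithTerminal.of y)) = R.arRestrict A y)
    (a : X ⟶ X') {y : DeltaSq} (b : join.obj y ⟶ m) :
    (ofHom ((adjunctToLimit β (op m)).map a)).grid b =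
      R.gridToShape b ⋙ R.shapeToAr m ⋙ natTransToArrow (Iso.hom a) := by
  change natTransToArrow (Iso.hom (show IsoFull.obj (P := gridProp A (R.shift.obj y)) _ ≅
    IsoFull.obj (P := gridProp A (R.shift.obj y)) _ from (β.app (op (WithTerminal.of y))).map
      (((exactS A).map (R.functor.map b).op).map a))) = _
  rw [hβ]
  exact congrArg (· ⋙ natTransToArrow (Iso.hom a)) (R.gridToAr_comp_arMap b)

theorem surjective_adjunctToLimit (hβ : ∀ y, β.app (op (WithTerminal.of y)) = R.arRestrict A y)
    (hε : IsZeroAugmentation ε) : Function.Surjective (adjunctToLimit β (op m)).obj := fun x => by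
  obtain ⟨F, hF, hF₀⟩ := exists_extension_vanishesOutside
    RowExtension.shapeToAr_obj_injective RowExtension.isCosieve_shapeToAr (ofObj x).glue
  have hA : arProp A (R.functor.obj m) F := RowExtension.arProp_of_shapeToAr
    (by rw [hF]; exact isAdmissible_glue_ofObj)
    (fun z hz => by rw [hF]; exact isZero_glue_ofObj hε hz) hF₀
  refine ⟨⟨F, hA⟩, genLimit_obj_ext (by rw [Preaug.mk_aug]; exact hε.injective) fun b =>
    IsoFull.obj_injective ?_⟩
  exact (grid_ofObj_adjunctToLimit hβ _ b).trans (by rw [hF, gridToShape_comp_glue]; rfl)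

theorem full_adjunctToLimit (hβ : ∀ y, β.app (op (WithTerminal.of y)) = R.arRestrict A y)
    (hε : IsZeroAugmentation ε) : Functor.Full (adjunctToLimit β (op m)) where
  map_surjective {X X'} a := by
    obtain ⟨τ, hτ⟩ := exists_iso_of_hom a (F := R.shapeToAr m ⋙ IsoFull.obj X)
      (G := R.shapeToAr m ⋙ IsoFull.obj X') (grid_ofObj_adjunctToLimit hβ X)
      (grid_ofObj_adjunctToLimit hβ X')
    obtain ⟨σ, hσ⟩ := VanishesOutside.exists_iso RowExtension.shapeToAr_obj_injective
      (RowExtension.vanishesOutside_of_arProp (IsoFull.property X))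
      (RowExtension.vanishesOutside_of_arProp (IsoFull.property X')) τ
    refine ⟨σ, genLimit_hom_ext (by rw [Preaug.mk_aug]; exact hε.faithful) fun {y} b =>
      isoFull_hom_ext (P := gridProp A (R.shift.obj y)) ?_⟩
    calc (ofHom ((adjunctToLimit β (op m)).map σ)).grid b
      _ = R.gridToShape b ⋙ natTransToArrow (Functor.whiskerLeft (R.shapeToAr m) σ.hom) :=
        grid_ofHom_adjunctToLimit hβ σ b
      _ = (ofHom a).grid b := by rw [hσ, hτ]

theorem faithful_adjunctToLimit (hβ : ∀ y, β.app (op (WithTerminal.of y)) = R.arRestrict A y) :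
    Functor.Faithful (adjunctToLimit β (op m)) where
  map_injective {X X' a a'} h := Iso.ext <|
    (RowExtension.vanishesOutside_of_arProp (IsoFull.property X)).hom_ext <|
      shape_natTrans_ext fun k => natTransToArrow_injective <|
        (grid_ofHom_adjunctToLimit hβ a (cut k)).symm.trans <| by
          rw [h]
          exact grid_ofHom_adjunctToLimit hβ a' (cut k)

theorem isSurjectiveEquivalence_adjunctToLimit
    (hβ : ∀ y, β.app (op (WithTerminal.of y)) = R.arRestrict A y) (hε : IsZeroAugmentation ε)
    (n : SimplexCategoryᵒᵖ) : IsSurjectiveEquivalence (adjunctToLimit β n) where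
  full := full_adjunctToLimit hβ hε
  faithful := faithful_adjunctToLimit hβ
  surjective := surjective_adjunctToLimit hβ hε

theorem isIso_adjunctToLimit (hR : ∀ m, Function.Surjective (R.unit.app m).toOrderHom)
    (hβ : ∀ y, β.app (op (WithTerminal.of y)) = R.arRestrict A y) (hε : IsZeroAugmentation ε)
    (n : SimplexCategoryᵒᵖ) : IsIso (adjunctToLimit β n) := by
  refine (isSurjectiveEquivalence_adjunctToLimit hβ hε n).isIso fun X X' h =>
    IsoFull.obj_injective ?_
  have h' : R.shapeToAr n.unop ⋙ IsoFull.obj X = R.shapeToAr n.unop ⋙ IsoFull.obj X' :=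
    shape_functor_ext fun k => by
      rw [← grid_ofObj_adjunctToLimit hβ X, ← grid_ofObj_adjunctToLimit hβ X']
      exact congrArg (fun x => (ofObj x).grid (cut k)) h
  exact functor_eq_of_comp_eq _ (RowExtension.shapeToAr_obj_surjective (hR _)) h'

end AdjunctToLimit

section ExactNerve

variable {A : Type u} [Category.{v} A] [Preadditive A] [HasFiniteBiproducts A] [ExactCategory A]

/-- The augmentation of the exact nerve. -/
abbrev nerveAug (A : Type u) [Category.{v} A] [Preadditive A] [HasFiniteBiproducts A]
    [ExactCategory A] : Grpd.of (IsoFull (zeroProp A)) ⟶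
      (nerveBisimplicial A).obj (op (RowExtension.identity.shift.obj zz)) :=
  (IsoFull.map (𝟭 _) (fun _ h => gridProp_of_zero h) :
    IsoFull (zeroProp A) ⥤ IsoFull (gridProp A zz))

theorem isZeroAugmentation_nerveAug : IsZeroAugmentation (nerveAug A) where
  injective _ _ h := IsoFull.obj_injective (congrArg (IsoFull.obj (P := gridProp A zz)) h)
  faithful := ⟨fun h => h⟩
  isZero z := (show IsoFull (zeroProp A) from z).property _

theorem isZeroAugmentation_aug_exactNerve :
    IsZeroAugmentation (R := RowExtension.identity) (exactNerve A).aug := by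
  rw [show (exactNerve A).aug = nerveAug A from Preaug.mk_aug _ _ _]
  exact isZeroAugmentation_nerveAug

theorem comparisonAdj_app_of (y : DeltaSq) : (comparisonAdj A).app (op (WithTerminal.of y)) =
    RowExtension.identity.arRestrict A y := by
  have h : gridToAr y = RowExtension.identity.gridToAr y :=
    CategoryTheory.Functor.ext (fun _ => ar_ext rfl rfl) (fun _ _ _ => ar_hom_ext _ _)
  exact IsoFull.map_congr (P := arProp A (join.obj y)) (Q := gridProp A y)
    (congrArg (fun G => (Functor.whiskeringLeft _ _ A).obj G) h)
    (fun X hX => ((arToGrid A y).obj ⟨X, hX⟩).property)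
    (fun X hX => IsoFull.property (P := gridProp A y)
      ((RowExtension.identity.arRestrict A y).obj ⟨X, hX⟩))

instance isIso_comparison : IsIso (comparison A) := by
  have (n : SimplexCategoryᵒᵖ) : IsIso ((comparison A).app n) :=
    isIso_homEquiv_app (isIso_adjunctToLimit (R := RowExtension.identity) (ε := nerveAug A)
      (fun _ => Function.surjective_id) comparisonAdj_app_of isZeroAugmentation_nerveAug n)
  exact NatIso.isIso_of_isIso_app _

end ExactNerve

section Path

variable {B : Type u} [Category.{v} B] [Preadditive B] [HasFiniteBiproducts B] [ExactCategory B]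

/-- The augmentation of the initial path construction on the exact nerve. -/
noncomputable abbrev pathNerveAug (B : Type u) [Category.{v} B] [Preadditive B]
    [HasFiniteBiproducts B] [ExactCategory B] : (exactNerve B).pathAug ⟶
      (nerveBisimplicial B).obj (op (RowExtension.cone.shift.obj zz)) :=
  pullback.fst _ _

theorem isPullback_pathNerveAug : IsPullback (pathNerveAug B) (pullback.snd _ _)
    ((exactNerve B).under.map (Quiver.Hom.op (show zz ⟶ (j.prod (𝟭 _)).obj zz from
      (toJ.app ⦋0⦌, 𝟙 _)))) (exactNerve B).aug :=
  IsPullback.of_hasPullback _ _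

theorem isZeroAugmentation_pathNerveAug : IsZeroAugmentation (pathNerveAug B) where
  injective := obj_fst_injective_of_isPullback isPullback_pathNerveAug
    isZeroAugmentation_aug_exactNerve.injective
  faithful := faithful_fst_of_isPullback isPullback_pathNerveAug
    isZeroAugmentation_aug_exactNerve.faithful
  isZero z := by
    have h := CategoryTheory.Functor.congr_obj isPullback_pathNerveAug.w z
    exact IsZero.of_iso (isZeroAugmentation_aug_exactNerve.isZero _)
      (eqToIso (congrArg (fun X : IsoFull (gridProp B zz) => X.obj.obj (0, 0)) h))

/-- The map `p^* P S^e(B) ⟶ P N^e(B)` adjoint to the composite of the comparison maps. -/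
noncomputable def pathAdj (B : Type u) [Category.{v} B] [Preadditive B] [HasFiniteBiproducts B]
    [ExactCategory B] : p.op ⋙ (path _).obj (exactS B) ⟶ (exactNerve B).path :=
  Functor.whiskerLeft p.op ((path _).map (comparison B)) ≫ pathComparisonAdj (exactNerve B)

theorem homEquiv_pathAdj : (p.op.ranAdjunction _).homEquiv _ _ (pathAdj B) =
    (path _).map (comparison B) ≫ pathComparison (exactNerve B) :=
  Adjunction.homEquiv_naturality_left _ _ _

theorem pathAdj_app_of (y : DeltaSq) : (pathAdj B).app (op (WithTerminal.of y)) =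
    (exactS B).map (assocJ.app y).op ≫ arToGrid B ((j.prod (𝟭 _)).obj y) := by
  let counit : ((genS _).obj (exactNerve B)).obj (op (join.obj ((j.prod (𝟭 _)).obj y))) ⟶ _ :=
    (p.op.ranCounit.app (exactNerve B)).app (op (WithTerminal.of ((j.prod (𝟭 _)).obj y)))
  refine ((comparison B).naturality_assoc (assocJ.app y).op counit).symm.trans ?_
  exact congrArg ((exactS B).map (assocJ.app y).op ≫ ·) (NatTrans.congr_app
    (whiskerLeft_homEquiv_ranCounit (comparisonAdj B))
    (op (WithTerminal.of ((j.prod (𝟭 _)).obj y))))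

theorem j_map_joinInl_val {y : DeltaSq} (a : Ord (j.obj y.1)) :
    ((j.map (joinInl y ≫ 𝟙 _)).toOrderHom a).val = a.val := by
  obtain ⟨i, hi⟩ | ⟨i, hi⟩ := join_cases 0 y.1.len a
  · exact (joinHom_left (𝟙 (⦋0⦌ : SimplexCategory)) _ a i hi).trans hi.symm
  · exact (joinHom_right (𝟙 (⦋0⦌ : SimplexCategory)) _ a i hi).trans hi.symm

theorem gridToAr_comp_arMap_assocJ (y : DeltaSq) :
    gridToAr ((j.prod (𝟭 _)).obj y) ⋙ arMap (assocJ.app y) = RowExtension.cone.gridToAr y :=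
  CategoryTheory.Functor.ext (fun z => ar_ext
      (Fin.ext (j_map_joinInl_val z.1).symm)
      (Fin.ext (by
        change 0 + y.1.len + 1 + 1 + z.2.val = y.1.len + 1 + z.2.val + 1
        omega)))
    (fun _ _ _ => ar_hom_ext _ _)

theorem pathAdj_app_of_eq_arRestrict (y : DeltaSq) :
    (pathAdj B).app (op (WithTerminal.of y)) = RowExtension.cone.arRestrict B y := by
  rw [pathAdj_app_of]
  exact IsoFull.map_congr (P := arProp B (j.obj (join.obj y)))
    (Q := gridProp B ((j.prod (𝟭 _)).obj y))
    (congrArg (fun G => (Functor.whiskeringLeft _ _ B).obj G) (gridToAr_comp_arMap_assocJ y))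
    (fun X hX => (((exactS B).map (assocJ.app y).op ⋙
      arToGrid B ((j.prod (𝟭 _)).obj y)).obj ⟨X, hX⟩).property)
    (fun X hX => IsoFull.property (P := gridProp B ((j.prod (𝟭 _)).obj y))
      ((RowExtension.cone.arRestrict B y).obj ⟨X, hX⟩))

theorem isSurjectiveEquivalence_path_comparison (n : SimplexCategoryᵒᵖ) : IsSurjectiveEquivalence
    (((path _).map (comparison B) ≫ pathComparison (exactNerve B)).app n) := by
  rw [← homEquiv_pathAdj]
  exact isSurjectiveEquivalence_homEquiv_app (isSurjectiveEquivalence_adjunctToLimit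
    (R := RowExtension.cone) (ε := pathNerveAug B) pathAdj_app_of_eq_arRestrict
    isZeroAugmentation_pathNerveAug n)

theorem isSurjectiveEquivalence_pathComparison (n : SimplexCategoryᵒᵖ) :
    IsSurjectiveEquivalence ((pathComparison (exactNerve B)).app n) :=
  IsSurjectiveEquivalence.of_isIso_comp (G := ((path _).map (comparison B)).app n)
    (isSurjectiveEquivalence_path_comparison n)

end Path

/-! ## The relative constructions -/

section Relative

variable {C : Type*} [Category* C]

theorem Preaug.hom_ext {Y Y' : Preaug C} {α β : Y ⟶ Y'}
    (h : ∀ y, α.app (op (WithTerminal.of y)) = β.app (op (WithTerminal.of y)))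
    (h' : α.app (op WithTerminal.star) = β.app (op WithTerminal.star)) : α = β := by
  ext ⟨x⟩
  match x with
  | .of y => exact h y
  | .star => exact h'

theorem path_map_pathD₀ {X X' : SimplexCategoryᵒᵖ ⥤ C} (c : X ⟶ X') :
    (path C).map c ≫ pathD₀ X' = pathD₀ X ≫ c := by
  ext n
  exact (c.naturality (toJ.app n.unop).op).symm

variable [HasLimitsOfSize.{0, 0} C]

theorem pathComparisonAdj_pathD₀ (Y : Preaug C) :
    pathComparisonAdj Y ≫ Y.pathD₀ =
      Functor.whiskerLeft p.op (pathD₀ ((genS C).obj Y)) ≫ p.op.ranCounit.app Y := by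
  refine Preaug.hom_ext (fun y => ?_) (pullback.lift_snd _ _ _)
  let S := (genS C).obj Y
  let y' : DeltaSq := (j.prod (𝟭 _)).obj y
  let g : y ⟶ y' := (toJ.app y.1, 𝟙 _)
  let Sg : S.obj (op (join.obj y')) ⟶ S.obj (op (join.obj y)) := S.map (join.map g).op
  let Yg : Y.obj (op (WithTerminal.of y')) ⟶ Y.obj (op (WithTerminal.of y)) :=
    Y.map (WithTerminal.incl.map g).op
  let assoc : S.obj (op (j.obj (join.obj y))) ⟶ S.obj (op (join.obj y')) :=
    S.map (assocJ.app y).op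
  let counit (x : DeltaSq) : S.obj (op (join.obj x)) ⟶ Y.obj (op (WithTerminal.of x)) :=
    (p.op.ranCounit.app Y).app (op (WithTerminal.of x))
  have counit_naturality : counit y' ≫ Yg = Sg ≫ counit y :=
    ((p.op.ranCounit.app Y).naturality (WithTerminal.incl.map g).op).symm
  have assoc_comp : assoc ≫ Sg = S.map (toJ.app (join.obj y)).op :=
    (S.map_comp _ _).symm.trans
      (congrArg (fun t => S.map (Quiver.Hom.op t)) (joinHom_inclJ y.1 y.2))
  exact calc (assoc ≫ counit y') ≫ Yg
    _ = (assoc ≫ Sg) ≫ counit y := by simp only [Category.assoc, counit_naturality]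
    _ = S.map (toJ.app (join.obj y)).op ≫ counit y := by rw [assoc_comp]

theorem pathComparison_pathD₀ (Y : Preaug C) :
    pathComparison Y ≫ (genS C).map Y.pathD₀ = pathD₀ ((genS C).obj Y) :=
  calc pathComparison Y ≫ (genS C).map Y.pathD₀
    _ = (p.op.ranAdjunction C).homEquiv _ _ (pathComparisonAdj Y ≫ Y.pathD₀) :=
      (Adjunction.homEquiv_naturality_right _ _ _).symm
    _ = (p.op.ranAdjunction C).homEquiv _ _
          (((p.op.ranAdjunction C).homEquiv _ _).symm (pathD₀ ((genS C).obj Y))) := by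
      rw [pathComparisonAdj_pathD₀, Adjunction.homEquiv_counit, Functor.ranAdjunction_counit]
      rfl
    _ = pathD₀ ((genS C).obj Y) := Equiv.apply_symm_apply _ _

end Relative

section Exact

variable {A : Type u} [Category.{v} A] [Preadditive A] [HasFiniteBiproducts A] [ExactCategory A]
variable {B : Type u} [Category.{v} B] [Preadditive B] [HasFiniteBiproducts B] [ExactCategory B]

theorem comparison_naturality (f : A ⥤ B) [f.Additive] [IsExactFunctor f] :
    comparison A ≫ (genS _).map (exactNerveMap f) = exactSMap f ≫ comparison B := by
  refine (Adjunction.homEquiv_naturality_right _ _ _).symm.trans (Eq.trans ?_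
    (Adjunction.homEquiv_naturality_left _ _ _))
  exact congrArg _ (Preaug.hom_ext (fun _ => rfl) rfl)

theorem path_comparison_pathD₀ :
    ((path _).map (comparison B) ≫ pathComparison (exactNerve B)) ≫
      (genS _).map (exactNerve B).pathD₀ = pathD₀ (exactS B) ≫ comparison B := by
  rw [Category.assoc, pathComparison_pathD₀, path_map_pathD₀]

theorem exists_relComparison (f : A ⥤ B) [f.Additive] [IsExactFunctor f] :
    ∃ w : relS f ⟶ (genS _).obj (relNerve f),
      IsPullback (pullback.fst _ _) w ((path _).map (comparison B) ≫
        pathComparison (exactNerve B)) ((genS _).map (pullback.fst _ _)) ∧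
      w ≫ (genS _).map (pullback.snd _ _) = pullback.snd _ _ ≫ comparison A := by
  have : (genS Grpd.{v, max v u}).IsRightAdjoint := (p.op.ranAdjunction _).isRightAdjoint
  have pb : IsPullback ((genS _).map (pullback.fst (exactNerve B).pathD₀ (exactNerveMap f)))
      ((genS _).map (pullback.snd _ _)) ((genS _).map (exactNerve B).pathD₀)
      ((genS _).map (exactNerveMap f)) := (IsPullback.of_hasPullback _ _).map (genS _)
  have pb₀ : IsPullback (pullback.fst (pathD₀ (exactS B)) (exactSMap f)) (pullback.snd _ _ ≫
      comparison A) (pathD₀ (exactS B) ≫ comparison B) ((genS _).map (exactNerveMap f)) :=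
    (IsPullback.of_hasPullback _ _).paste_vert (h₃₁ := (genS _).map (exactNerveMap f))
      (IsPullback.of_vert_isIso ⟨(comparison_naturality f).symm⟩)
  have e : (pullback.fst (pathD₀ (exactS B)) (exactSMap f) ≫ (path _).map (comparison B) ≫
      pathComparison (exactNerve B)) ≫ (genS _).map (exactNerve B).pathD₀ =
      (pullback.snd _ _ ≫ comparison A) ≫ (genS _).map (exactNerveMap f) := by
    rw [Category.assoc, path_comparison_pathD₀]
    exact pb₀.w
  refine ⟨pb.lift _ _ e, ?_, pb.lift_snd _ _ _⟩
  refine IsPullback.of_bot ?_ (pb.lift_fst _ _ e).symm pb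
  rw [pb.lift_snd, path_comparison_pathD₀]
  exact pb₀

end Exact

end Sdot

theorem mainTheorem8 {A : Type u} [Category.{v} A] [Preadditive A] [HasFiniteBiproducts A]
    [Sdot.ExactCategory A] {B : Type u} [Category.{v} B] [Preadditive B] [HasFiniteBiproducts B]
    [Sdot.ExactCategory B] (f : A ⥤ B) [f.Additive] [Sdot.IsExactFunctor f] :
    IsIso (Sdot.comparison A) ∧ IsIso (Sdot.comparison B) ∧
    Sdot.LevelwiseAcyclicFibration (Sdot.pathComparison (Sdot.exactNerve B)) ∧
    ∃ w : Sdot.relS f ⟶ (Sdot.genS _).obj (Sdot.relNerve f),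
      w ≫ (Sdot.genS _).map (pullback.fst _ _) =
        pullback.fst _ _ ≫ (Sdot.path _).map (Sdot.comparison B) ≫
          Sdot.pathComparison (Sdot.exactNerve B) ∧
      w ≫ (Sdot.genS _).map (pullback.snd _ _) = pullback.snd _ _ ≫ Sdot.comparison A ∧
      Sdot.LevelwiseWeakEquivalence w := by
  refine ⟨inferInstance, inferInstance, fun n => ?_, ?_⟩
  · have h := Sdot.isSurjectiveEquivalence_pathComparison (B := B) n
    exact ⟨h.isEquivalence, h.isIsofibration⟩
  · obtain ⟨w, pb, hw⟩ := Sdot.exists_relComparison f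
    refine ⟨w, pb.w.symm, hw, fun n => ?_⟩
    have h := Sdot.isSurjectiveEquivalence_path_comparison (B := B) n
    exact (h.of_isPullback (pb.map ((evaluation _ _).obj n))).isEquivalence
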